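/- **Setting.** Let $f:\mathbb R^n\to\mathbb R$ be convex with a minimizer $x^*$. For every $x$ let $\nabla f(x)$ denote the gradient of $f$ at $x$ (where $f$ is not differentiable, a fixed subgradient of $f$ at $x$, with $\nabla f(x^*)=0$ in case $f$ is not differentiable at $x^*$). Let $\nu\in[0,1]$, $M_\nu>0$, $R_0\ge\|x^0-x^*\|_2$, and assume the Hölder condition only on a ball: $$\|\nabla f(x)-\nabla f(y)\|_2\le M_\nu\|x-y\|_2^\nu\quad\text{for all }x,y\in B_{3R_0}(x^*)=\{x:\|x-x^*\|_2\le 3R_0\}.$$ Let $\xi$ be a random element and $\nabla f(x,\xi)$ a jointly measurable stochastic gradient with $\mathbb E_\xi[\nabla f(x,\xi)]=\nabla f(x)$ and $\mathbb E_\xi\|\nabla f(x,\xi)-\nabla f(x)\|_2^2\le\sigma^2$ for all $x\in\mathbb R^n$, where $\sigma>0$ (no other assumption on the tails). **Method (clipped-SSTM).** Given $\alpha,B>0$ and integers $m_k\ge1$, put $A_0=\alpha_0=0$, $y^0=z^0=x^0$ and, for $k=0,1,\dots,N-1$, $$\alpha_{k+1}=\alpha(k+1)^{\frac{2\nu}{1+\nu}},\quad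 A_{k+1}=A_k+\alpha_{k+1},\quad \lambda_{k+1}=\frac{B}{\alpha_{k+1}},\quad x^{k+1}=\frac{A_ky^k+\alpha_{k+1}z^k}{A_{k+1}},$$ $$z^{k+1}=z^k-\alpha_{k+1}\,\mathrm{clip}\Big(\frac1{m_k}\sum_{i=1}^{m_k}\nabla f(x^{k+1},\xi_i^k),\lambda_{k+1}\Big),\quad y^{k+1}=\frac{A_ky^k+\alpha_{k+1}z^{k+1}}{A_{k+1}},$$ where $\mathrm{clip}(v,\lambda)=\min\{1,\lambda/\|v\|_2\}\,v$ and all $\xi_i^k$ are independent copies of $\xi$. The output is $y^N$, and the number of oracle calls is $\sum_{k=0}^{N-1}m_k$. **Parameters.** Let $\varepsilon>0$, $\beta\in(0,1)$, $C=\sqrt7$, and for $N\ge1$, $a>0$ let $$\alpha=\frac{(\varepsilon/2)^{\frac{1-\nu}{1+\nu}}}{2^{\frac{2\nu}{1+\nu}}aM_\nu^{\frac2{1+\nu}}},\quad m_k=\left\lceil\max\Big\{1,\frac{20736N\sigma^2\alpha_{k+1}^2\ln\frac{4N}\beta}{C^2R_0^2}\Big\}\right\rceil,\quad B=\frac{CR_0}{16\ln\frac{4N}\beta}.$$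 Call $(a,N)$ *admissible* if $N\ge1$, $\ln\frac{4N}\beta\ge2$, $a\ge16384\ln^2\frac{4N}\beta$, $$N=\left\lceil\frac{2^{\frac{1+\nu}{1+3\nu}}a^{\frac{1+\nu}{1+3\nu}}C^{\frac{2(1+\nu)}{1+3\nu}}R_0^{\frac{2(1+\nu)}{1+3\nu}}M_\nu^{\frac2{1+3\nu}}}{\varepsilon^{\frac2{1+3\nu}}}\right\rceil+1,\tag{1}$$ $$\varepsilon^{\frac{1-\nu}{1+\nu}}\le\frac{aCM_\nu^{\frac{1-\nu}{1+\nu}}R_0^{1-\nu}}{16\ln\frac{4N}\beta},\qquad \varepsilon\le\frac{2^{\frac{1+\nu}2}a^{\frac{1+\nu}2}C^{1+\nu}R_0^{1+\nu}M_\nu}{100^{\frac{1+3\nu}2}},$$ $$\varepsilon^{\frac{1-\nu}{1+3\nu}}\le\min\left\{\frac{a^{\frac{2+3\nu-\nu^2}{2(1+3\nu)}}}{2^{2+4\nu+\frac{3+8\nu-5\nu^2-6\nu^3}{(1+\nu)(1+3\nu)}}\ln\frac{4N}\beta},\frac{a^{\frac{(1+\nu)^2}{1+3\nu}}}{2^{4+7\nu+\frac{2+7\nu+2\nu^2-3\nu^3}{(1+\nu)(1+3\nu)}}\ln^{1+\nu}\frac{4N}\beta}\right\}C^{\frac{1-\nu^2}{1+3\nu}}R_0^{\frac{1-\nu^2}{1+3\nu}}M_\nu^{\frac{1-\nu}{1+3\nu}}.$$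 **Theorem.** 1. For every admissible $(a,N)$, clipped-SSTM with these parameters satisfies, with probability at least $1-\beta$, $$f(y^N)-f(x^*)\le\frac{4aC^2R_0^2M_\nu^{\frac2{1+\nu}}}{N^{\frac{1+3\nu}{1+\nu}}\varepsilon^{\frac{1-\nu}{1+\nu}}}.$$ 2. There are $a$ and $N$ satisfying both (1) and $a=16384\ln^2\frac{4N}\beta$. 3. If $(a,N)$ is admissible and $a=16384\ln^2\frac{4N}\beta$, then $f(y^N)-f(x^*)\le\varepsilon$ with probability at least $1-\beta$. Moreover, let $D=M_\nu^{\frac2{1+3\nu}}R_0^{\frac{2(1+\nu)}{1+3\nu}}\varepsilon^{-\frac2{1+3\nu}}$. For every $q>1$ there is a constant $c>0$ depending on $q$ only (not on $n$, $f$, $\nu$, $M_\nu$, $R_0$, $\sigma$, $\varepsilon$, $\beta$, or the noise) such that, whenever $D/\beta\ge q$, the numbers of iterations and of oracle calls satisfy $$N\le c\,D\ln^{\frac{2(1+\nu)}{1+3\nu}}\frac D\beta,\qquad \sum_{k=0}^{N-1}m_k\le c\max\left\{D\ln^{\frac{2(1+\nu)}{1+3\nu}}\frac D\beta,\ \frac{\sigma^2R_0^2}{\varepsilon^2}\ln\frac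 D\beta\right\}.$$ -/

import Mathlib

open MeasureTheory ProbabilityTheory

noncomputable section

namespace ClippedSSTM

/-- The Euclidean space `ℝⁿ`. -/
abbrev Space (n : ℕ) : Type := EuclideanSpace ℝ (Fin n)

/-! ### The algorithm -/

/-- The clipping operator `clip(v, l) = min {1, l / ‖v‖} v` (equal to `0` at `v = 0`). -/
def clip {n : ℕ} (v : Space n) (l : ℝ) : Space n :=
  min 1 (l / ‖v‖) • v

/-- The mini-batched stochastic gradient `(1 / m) ∑_{i < m} ∇f(x, ξ_i)`, where
`g x s` stands for `∇f(x, s)`. -/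
def miniBatch {n : ℕ} {Ξ : Type*} (g : Space n → Ξ → Space n) (x : Space n) (m : ℕ)
    (ξ : ℕ → Ξ) : Space n :=
  (1 / (m : ℝ)) • ∑ i ∈ Finset.range m, g x (ξ i)

/-- The stepsizes `α_0 = 0`, `α_{k+1} = α (k + 1)^{2ν/(1+ν)}`. -/
def stepSize (α ν : ℝ) : ℕ → ℝ
  | 0 => 0
  | k + 1 => α * ((k : ℝ) + 1) ^ (2 * ν / (1 + ν))

/-- The accumulated stepsizes `A_0 = 0`, `A_{k+1} = A_k + α_{k+1}`. -/
def stepSum (α ν : ℝ) : ℕ → ℝ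
  | 0 => 0
  | k + 1 => stepSum α ν k + stepSize α ν (k + 1)

/-- The clipping levels `λ_k = B / α_k` (used for `k ≥ 1` only). -/
def clipLevel (α ν B : ℝ) (k : ℕ) : ℝ :=
  B / stepSize α ν k

/-- The pair of sequences `(y^k, z^k)` kept by the method. -/
structure State (n : ℕ) where
  y : Space n
  z : Space n

/-- The query point `x^{k+1} = (A_k y^k + α_{k+1} z^k) / A_{k+1}`. -/
def queryPoint {n : ℕ} (α ν : ℝ) (k : ℕ) (s : State n) : Space n :=
  (1 / stepSum α ν (k + 1)) • (stepSum α ν k • s.y + stepSize α ν (k + 1) • s.z)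

/-- The update `z^{k+1} = z^k - α_{k+1} clip(∇f(x^{k+1}, ξ^k), λ_{k+1})`, where
`∇f(x^{k+1}, ξ^k)` is computed from the mini-batch `ξ^k` of size `m`. -/
def nextZ {n : ℕ} {Ξ : Type*} (g : Space n → Ξ → Space n) (α ν B : ℝ) (m : ℕ) (k : ℕ)
    (ξ : ℕ → Ξ) (s : State n) : Space n :=
  s.z - stepSize α ν (k + 1) •
    clip (miniBatch g (queryPoint α ν k s) m ξ) (clipLevel α ν B (k + 1))

/-- The state of clipped-SSTM after `k` iterations, started at `y^0 = z^0 = x0`, with stepsize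
parameter `α`, Hölder exponent `ν`, clipping parameter `B` and batchsizes `m`. Iteration `k` uses
the samples `ξ k 0, …, ξ k (m k - 1)`, and `y^{k+1} = (A_k y^k + α_{k+1} z^{k+1}) / A_{k+1}`. -/
def iterate {n : ℕ} {Ξ : Type*} (g : Space n → Ξ → Space n) (α ν B : ℝ) (m : ℕ → ℕ)
    (x0 : Space n) (ξ : ℕ → ℕ → Ξ) : ℕ → State n
  | 0 => ⟨x0, x0⟩
  | k + 1 =>
    let s := iterate g α ν B m x0 ξ k
    let z' := nextZ g α ν B (m k) k (ξ k) s
    ⟨(1 / stepSum α ν (k + 1)) • (stepSum α ν k • s.y + stepSize α ν (k + 1) • z'), z'⟩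

/-- The number of stochastic gradients `∇f(x, ξ)` computed in the first `N` iterations: iteration
`k` evaluates one for each of its `m k` samples. -/
def oracleCalls (m : ℕ → ℕ) (N : ℕ) : ℕ :=
  ∑ k ∈ Finset.range N, m k

/-! ### The parameters -/

/-- The constant `C = √7`. -/
def C : ℝ := Real.sqrt 7

/-- The logarithmic factor `ln (4N / β)`. -/
def logFactor (N : ℕ) (β : ℝ) : ℝ :=
  Real.log (4 * (N : ℝ) / β)

/-- The stepsize parameter
`α = (ε/2)^{(1-ν)/(1+ν)} / (2^{2ν/(1+ν)} a M^{2/(1+ν)})`. -/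
def stepParam (ν M ε a : ℝ) : ℝ :=
  (ε / 2) ^ ((1 - ν) / (1 + ν)) /
    ((2 : ℝ) ^ (2 * ν / (1 + ν)) * a * M ^ (2 / (1 + ν)))

/-- The clipping parameter `B = C R₀ / (16 ln (4N/β))`. -/
def clipParam (R₀ β : ℝ) (N : ℕ) : ℝ :=
  C * R₀ / (16 * logFactor N β)

/-- The batchsizes `m_k = max {1, 20736 N σ² α_{k+1}² ln (4N/β) / (C² R₀²)}`, rounded up to an
integer. -/
def batchSize (ν M R₀ σ ε β a : ℝ) (N : ℕ) (k : ℕ) : ℕ :=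
  ⌈max 1 (20736 * (N : ℝ) * σ ^ 2 * stepSize (stepParam ν M ε a) ν (k + 1) ^ 2 * logFactor N β /
    (C ^ 2 * R₀ ^ 2))⌉₊

/-- The number of iterations
`⌈2^{(1+ν)/(1+3ν)} a^{(1+ν)/(1+3ν)} C^{2(1+ν)/(1+3ν)} R₀^{2(1+ν)/(1+3ν)} M^{2/(1+3ν)}
/ ε^{2/(1+3ν)}⌉ + 1`. -/
def iterationCount (ν M R₀ ε a : ℝ) : ℕ :=
  ⌈(2 : ℝ) ^ ((1 + ν) / (1 + 3 * ν)) * a ^ ((1 + ν) / (1 + 3 * ν)) *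
      C ^ (2 * (1 + ν) / (1 + 3 * ν)) * R₀ ^ (2 * (1 + ν) / (1 + 3 * ν)) *
      M ^ (2 / (1 + 3 * ν)) / ε ^ (2 / (1 + 3 * ν))⌉₊ + 1

/-- The conditions that tie together the number of iterations `N`, the stepsize parameter `a`, the
accuracy `ε` and the confidence level `β`. -/
structure Admissible (ν M R₀ ε β a : ℝ) (N : ℕ) : Prop where
  one_le : 1 ≤ N
  log_ge : 2 ≤ logFactor N β
  a_ge : 16384 * logFactor N β ^ 2 ≤ a
  eps_le₁ : ε ^ ((1 - ν) / (1 + ν)) ≤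
    a * C * M ^ ((1 - ν) / (1 + ν)) * R₀ ^ (1 - ν) / (16 * logFactor N β)
  eps_le₂ : ε ≤ (2 : ℝ) ^ ((1 + ν) / 2) * a ^ ((1 + ν) / 2) * C ^ (1 + ν) * R₀ ^ (1 + ν) * M /
    (100 : ℝ) ^ ((1 + 3 * ν) / 2)
  eps_le₃ : ε ^ ((1 - ν) / (1 + 3 * ν)) ≤
    min
      (a ^ ((2 + 3 * ν - ν ^ 2) / (2 * (1 + 3 * ν))) /
        ((2 : ℝ) ^ (2 + 4 * ν +
            (3 + 8 * ν - 5 * ν ^ 2 - 6 * ν ^ 3) / ((1 + ν) * (1 + 3 * ν))) *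
          logFactor N β))
      (a ^ ((1 + ν) ^ 2 / (1 + 3 * ν)) /
        ((2 : ℝ) ^ (4 + 7 * ν +
            (2 + 7 * ν + 2 * ν ^ 2 - 3 * ν ^ 3) / ((1 + ν) * (1 + 3 * ν))) *
          logFactor N β ^ (1 + ν))) *
      C ^ ((1 - ν ^ 2) / (1 + 3 * ν)) * R₀ ^ ((1 - ν ^ 2) / (1 + 3 * ν)) *
      M ^ ((1 - ν) / (1 + 3 * ν))
  count_eq : N = iterationCount ν M R₀ ε a

/-- The output `y^N` of clipped-SSTM run with the parameters above from `x0` on the samples `ξ`. -/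
def output {n : ℕ} {Ξ : Type*} (g : Space n → Ξ → Space n) (ν M R₀ σ ε β a : ℝ) (N : ℕ)
    (x0 : Space n) (ξ : ℕ → ℕ → Ξ) : Space n :=
  (iterate g (stepParam ν M ε a) ν (clipParam R₀ β N) (batchSize ν M R₀ σ ε β a N) x0 ξ N).y

/-- The quantity `D = M^{2/(1+3ν)} R₀^{2(1+ν)/(1+3ν)} / ε^{2/(1+3ν)}`. -/
def complexityD (ν M R₀ ε : ℝ) : ℝ :=
  M ^ (2 / (1 + 3 * ν)) * R₀ ^ (2 * (1 + ν) / (1 + 3 * ν)) / ε ^ (2 / (1 + 3 * ν))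

end ClippedSSTM

end

/-!
Clipped-SSTM is an accelerated method whose energy `A_k (f(y^k) - f(x*)) + ‖z^k - x*‖² / 2` would
decrease if the gradients were exact. With a clipped stochastic gradient, of error `θ` against the
subgradient at the query point, one iteration adds at most `a ⟨θ, x* - z⟩ + a² ‖θ‖²`
(with `a = α_{k+1}`) and a Hölder remainder (`LocallyHolder.energy_step`). The remainder
`M d^{1+ν}` is split at a threshold of order `R₀ / √N`: long steps are absorbed by the squares in the
energy inequality and short ones add up to a small multiple of `R₀²` (`Tuned.remainder`). So as long
as the accumulated noise is at most `5 R₀² / 2`, the energy is at most `7 R₀² / 2`, the iterates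
stay in the ball of radius `√7 R₀`, where the Hölder condition holds, and the gradients at the
query points are at most half the clipping level (`energy_le`).

For the noise, clipping is the projection onto a ball. It therefore does not increase the distance
to the true gradient, which lies in this ball, and its bias is bounded by the squared batch error
divided by the clipping level. Hence the exponential of the noise of an iteration, scaled by
`L / (2 R₀²)` with `L = ln (4N/β)`, is at most `1` plus a term of mean zero plus a multiple of the
squared batch error (`exp_noiseTerm_le`), and the batchsizes make its mean at most
`exp (L / (4N))`. The noise process is frozen once it exceeds `5 R₀² / 2` or meets a point that is
not controlled, so that this estimate holds at every step, conditionally on the past; by Fubini's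
theorem the exponential moment after `N` steps is at most `exp (L / 4)`, and Markov's inequality
gives a failure probability of at most `exp (-L) ≤ β` (`measure_stoppedNoise_gt_le`). Since the
process is frozen, its final value controls all earlier ones, and no union bound over the
iterations or maximal inequality is needed.

The parameters enter through the scaling identities `stepParam_mul_rpow` and `const_mul_stepParam`:
with `X` the unrounded iteration count and `p = (1+3ν)/(1+ν)`, they say that `α X^p = 7 R₀² / ε`, and
express `M α` by `X`, `a` and `R₀` alone. The bound `a ≥ (128 L)²` absorbs all numerical constants
(`tuned_stepParam`). For `a = 16384 L²` the count gives `N ≤ c L² D`, so that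
`L = ln (4N/β)` is at most a multiple of `ln (D/β)` (`logFactor_le`), which yields the complexity
bounds.
-/

namespace ClippedSSTM

/-! ### Subgradients that are Hölder continuous on a ball -/

/-- The local regularity of the objective: `G` is a field of subgradients of `f` that vanishes at
the minimizer `xs` and is `ν`-Hölder with constant `M` on the ball of radius `3 R₀` about `xs`. -/
structure LocallyHolder {n : ℕ} (f : Space n → ℝ) (G : Space n → Space n) (xs : Space n)
    (ν M R₀ : ℝ) : Prop where
  nonneg : 0 ≤ ν
  le_one : ν ≤ 1
  const_pos : 0 < M
  subgrad : ∀ x y, f x + inner ℝ (G x) (y - x) ≤ f y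
  grad_min : G xs = 0
  holder : ∀ x ∈ Metric.closedBall xs (3 * R₀), ∀ y ∈ Metric.closedBall xs (3 * R₀),
    ‖G x - G y‖ ≤ M * ‖x - y‖ ^ ν

/-- A subgradient at a minimizer vanishes when the function is differentiable there: tilting the
function by the subgradient keeps the point a minimizer. -/
lemma subgradient_eq_zero_of_isMin {n : ℕ} {f : Space n → ℝ} {xs v : Space n}
    (hmin : ∀ x, f xs ≤ f x) (hv : ∀ y, f xs + inner ℝ v (y - xs) ≤ f y)
    (hd : DifferentiableAt ℝ f xs) : v = 0 := by
  have h1 : fderiv ℝ f xs = 0 :=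
    IsLocalMin.fderiv_eq_zero (Filter.Eventually.of_forall hmin)
  have hl : HasFDerivAt (fun y : Space n => inner ℝ v y) (innerSL ℝ v) xs :=
    (innerSL ℝ v).hasFDerivAt
  have h2 : HasFDerivAt (fun y => f y - inner ℝ v y) (fderiv ℝ f xs - innerSL ℝ v) xs :=
    hd.hasFDerivAt.sub hl
  have h3 : IsLocalMin (fun y => f y - inner ℝ v y) xs := by
    refine Filter.Eventually.of_forall fun y => ?_
    have := hv y
    rw [inner_sub_right] at this
    dsimp only
    linarith
  have h4 := h3.hasFDerivAt_eq_zero h2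
  rw [h1, zero_sub, neg_eq_zero] at h4
  have h5 : inner ℝ v v = (0 : ℝ) := by
    have := congrArg (fun l => l v) h4
    simpa using this
  exact inner_self_eq_zero.1 h5

namespace LocallyHolder

variable {n : ℕ} {f : Space n → ℝ} {G : Space n → Space n} {xs : Space n} {ν M R₀ : ℝ}

lemma min_le (h : LocallyHolder f G xs ν M R₀) (x : Space n) : f xs ≤ f x := by
  simpa [h.grad_min] using h.subgrad xs x

/-- Descent inequality of a function with Hölder subgradients. -/
lemma le_add_inner (h : LocallyHolder f G xs ν M R₀) {x y : Space n}
    (hx : x ∈ Metric.closedBall xs (3 * R₀)) (hy : y ∈ Metric.closedBall xs (3 * R₀)) :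
    f y ≤ f x + inner ℝ (G x) (y - x) + M * ‖y - x‖ ^ (1 + ν) := by
  have h1 := h.subgrad y x
  have h2 : inner ℝ (G y - G x) (y - x) ≤ M * ‖y - x‖ ^ (1 + ν) := by
    calc inner ℝ (G y - G x) (y - x) ≤ ‖G y - G x‖ * ‖y - x‖ := real_inner_le_norm _ _
      _ ≤ M * ‖y - x‖ ^ ν * ‖y - x‖ := by gcongr; exact h.holder y hy x hx
      _ = M * ‖y - x‖ ^ (1 + ν) := by
        rw [Real.rpow_add_of_nonneg (norm_nonneg _) zero_le_one h.nonneg, Real.rpow_one]; ring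
  rw [inner_sub_left] at h2
  rw [← neg_sub y x, inner_neg_right] at h1
  linarith

/-- A step of length `t` against the subgradient cannot go below the minimum, which bounds the
subgradient by the function gap. -/
lemma mul_norm_le (h : LocallyHolder f G xs ν M R₀) {x : Space n} {t : ℝ} (ht : 0 ≤ t)
    (hx : ‖x - xs‖ + t ≤ 3 * R₀) : t * ‖G x‖ ≤ f x - f xs + M * t ^ (1 + ν) := by
  by_cases hG : G x = 0
  · have := h.min_le x
    have := mul_nonneg h.const_pos.le (Real.rpow_nonneg ht (1 + ν))
    simp only [hG, norm_zero, mul_zero]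
    linarith
  have hG' : ‖G x‖ ≠ 0 := norm_ne_zero_iff.2 hG
  set d : Space n := (t / ‖G x‖) • G x with hd
  have hdn : ‖d‖ = t := by
    rw [hd, norm_smul, Real.norm_of_nonneg (by positivity), div_mul_cancel₀ _ hG']
  have hxm : x ∈ Metric.closedBall xs (3 * R₀) := by
    rw [mem_closedBall_iff_norm]; linarith
  have hym : x - d ∈ Metric.closedBall xs (3 * R₀) := by
    rw [mem_closedBall_iff_norm]
    calc ‖x - d - xs‖ = ‖(x - xs) - d‖ := by congr 1; abel
      _ ≤ ‖x - xs‖ + ‖d‖ := norm_sub_le _ _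
      _ ≤ _ := by rw [hdn]; exact hx
  have h1 := h.le_add_inner hxm hym
  have h2 := h.min_le (x - d)
  have h3 : inner ℝ (G x) (x - d - x) = -(t * ‖G x‖) := by
    rw [sub_sub_cancel_left, inner_neg_right, hd, inner_smul_right, real_inner_self_eq_norm_sq]
    field_simp
  rw [h3, sub_sub_cancel_left, norm_neg, hdn] at h1
  linarith

lemma norm_grad_le (h : LocallyHolder f G xs ν M R₀) {x y : Space n}
    (hx : x ∈ Metric.closedBall xs (3 * R₀)) (hy : y ∈ Metric.closedBall xs (3 * R₀)) :
    ‖G x‖ ≤ ‖G y‖ + M * ‖x - y‖ ^ ν := by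
  have := norm_le_norm_add_norm_sub' (G x) (G y)
  linarith [h.holder x hx y hy]

end LocallyHolder

/-! ### Clipping is the projection onto a ball -/

section Clip

variable {n : ℕ}

/-- Clipping multiplies by a factor `c ∈ [0, 1]`, where `c < 1` only if the result has norm exactly
`l`. -/
lemma clip_eq_smul (v : Space n) {l : ℝ} (hl : 0 ≤ l) :
    ∃ c : ℝ, 0 ≤ c ∧ c ≤ 1 ∧ clip v l = c • v ∧ c * ‖v‖ ≤ l ∧ (1 - c) * (l - c * ‖v‖) = 0 := by
  rcases eq_or_ne v 0 with rfl | hv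
  · exact ⟨1, zero_le_one, le_rfl, by simp [clip], by simpa using hl, by simp⟩
  have h : ‖v‖ ≠ 0 := norm_ne_zero_iff.2 hv
  refine ⟨min 1 (l / ‖v‖), by positivity, min_le_left _ _, rfl, ?_, ?_⟩
  · calc _ ≤ l / ‖v‖ * ‖v‖ := by gcongr; exact min_le_right _ _
      _ = l := div_mul_cancel₀ _ h
  · rcases le_total 1 (l / ‖v‖) with h1 | h1
    · simp [min_eq_left h1]
    · rw [min_eq_right h1, div_mul_cancel₀ _ h, sub_self, mul_zero]

lemma norm_clip_le (v : Space n) {l : ℝ} (hl : 0 ≤ l) : ‖clip v l‖ ≤ l := by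
  obtain ⟨c, hc0, -, hc, hcl, -⟩ := clip_eq_smul v hl
  rwa [hc, norm_smul, Real.norm_of_nonneg hc0]

/-- Clipping at level `l` does not increase the distance to points of the ball of radius `l`. -/
lemma norm_clip_sub_le (v : Space n) {u : Space n} {l : ℝ} (hu : ‖u‖ ≤ l) :
    ‖clip v l - u‖ ≤ ‖v - u‖ := by
  obtain ⟨c, hc0, hc1, hc, hcl, hc2⟩ := clip_eq_smul v ((norm_nonneg u).trans hu)
  rw [hc]
  refine le_of_sq_le_sq ?_ (norm_nonneg _)
  have h1 : v - u = (c • v - u) + (1 - c) • v := by rw [sub_smul, one_smul]; abel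
  have h2 : inner ℝ u v ≤ l * ‖v‖ :=
    (real_inner_le_norm u v).trans (by gcongr)
  have h3 : 0 ≤ (1 - c) * (l * ‖v‖ - inner ℝ u v) := mul_nonneg (by linarith) (by linarith)
  rw [h1, norm_add_sq_real, inner_smul_right, inner_sub_left, real_inner_smul_left,
    real_inner_self_eq_norm_sq]
  have h4 : (1 - c) * (l - c * ‖v‖) * ‖v‖ = 0 := by rw [hc2, zero_mul]
  nlinarith [sq_nonneg ‖(1 - c) • v‖]

/-- The bias of clipping is quadratic in the distance to a point of the ball of half the radius. -/
lemma norm_clip_sub_self_le (v : Space n) {u : Space n} {l : ℝ} (hl : 0 < l)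
    (hu : ‖u‖ ≤ l / 2) : ‖clip v l - v‖ ≤ ‖v - u‖ ^ 2 / (2 * l) := by
  obtain ⟨c, hc0, hc1, hc, hcl, hc2⟩ := clip_eq_smul v hl.le
  have h1 : clip v l - v = -((1 - c) • v) := by rw [hc, sub_smul, one_smul]; abel
  rw [h1, norm_neg, norm_smul, Real.norm_of_nonneg (by linarith)]
  rcases mul_eq_zero.1 hc2 with h | h
  · rw [h, zero_mul]; positivity
  · have h2 : ‖v‖ ≤ ‖v - u‖ + ‖u‖ := by simpa using norm_add_le (v - u) u
    rw [le_div_iff₀ (by positivity)]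
    have h3 : (1 - c) * ‖v‖ ≤ ‖v - u‖ - l / 2 := by linarith
    nlinarith [sq_nonneg (‖v - u‖ - l)]

lemma measurable_clip (l : ℝ) : Measurable fun v : Space n => clip v l := by
  unfold clip
  fun_prop

end Clip

/-! ### Energy decrease in one iteration -/

lemma mix_mem_closedBall {n : ℕ} {A a r : ℝ} (hA : 0 ≤ A) (ha : 0 < a) {xs y z : Space n}
    (hy : y ∈ Metric.closedBall xs r) (hz : z ∈ Metric.closedBall xs r) :
    (1 / (A + a)) • (A • y + a • z) ∈ Metric.closedBall xs r := by
  have := (convex_closedBall xs r) hy hz (div_nonneg hA (by positivity : 0 ≤ A + a))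
    (by positivity : 0 ≤ a / (A + a)) (by field_simp)
  convert this using 1
  rw [smul_add, smul_smul, smul_smul, one_div_mul_eq_div, one_div_mul_eq_div]

/-- One iteration with gradient estimate `G x + th` decreases the energy
`A (f(y) - f(x*)) + ‖z - x*‖² / 2` up to the error `th` and the Hölder remainder `e`. The squares
of the gradient produced by `z'` and by the remainder cancel, so that only the noise
terms `⟨th, x* - z⟩` and `‖th‖²` are left. -/
lemma LocallyHolder.energy_step {n : ℕ} {f : Space n → ℝ} {G : Space n → Space n}
    {xs : Space n} {ν M R₀ : ℝ} (h : LocallyHolder f G xs ν M R₀) {A a e : ℝ} (hA : 0 ≤ A)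
    (ha : 0 < a) {x y z y' z' v : Space n}
    (hx : x = (1 / (A + a)) • (A • y + a • z)) (hz' : z' = z - a • v)
    (hy' : y' = (1 / (A + a)) • (A • y + a • z'))
    (hxm : x ∈ Metric.closedBall xs (3 * R₀)) (hym : y' ∈ Metric.closedBall xs (3 * R₀))
    (he : M * (A + a) * (a / (A + a) * (a * ‖v‖)) ^ (1 + ν) ≤ (a * ‖v‖) ^ 2 / 4 + e) :
    (A + a) * (f y' - f xs) + ‖z' - xs‖ ^ 2 / 2 ≤
      A * (f y - f xs) + ‖z - xs‖ ^ 2 / 2 +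
        (a * inner ℝ (v - G x) (xs - z) + a ^ 2 * ‖v - G x‖ ^ 2) + e := by
  have hS : 0 < A + a := by linarith
  have h1 := h.le_add_inner hxm hym
  have hyx : y' - x = (a / (A + a)) • (-(a • v)) := by
    rw [hx, hy', hz', ← smul_sub, show a / (A + a) = 1 / (A + a) * a by ring, mul_smul]
    congr 1
    module
  have hSx : (A + a) • x = A • y + a • z := by
    rw [hx, smul_smul, mul_one_div_cancel hS.ne', one_smul]
  have hnorm : ‖y' - x‖ = a / (A + a) * (a * ‖v‖) := by
    rw [hyx, norm_smul, norm_neg, norm_smul, Real.norm_of_nonneg (by positivity),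
      Real.norm_of_nonneg ha.le]
  rw [hnorm, hyx, inner_smul_right, inner_neg_right, inner_smul_right] at h1
  have h2 := h.subgrad x y
  have h3 := h.subgrad x xs
  have h4 : A * inner ℝ (G x) (y - x) + a * inner ℝ (G x) (xs - x) =
      a * inner ℝ (G x) (xs - z) := by
    have : A • (y - x) + a • (xs - x) = a • (xs - z) := by
      have : A • y + a • z - (A + a) • x = 0 := by rw [hSx, sub_self]
      calc A • (y - x) + a • (xs - x) = a • (xs - z) + (A • y + a • z - (A + a) • x) := by module
        _ = _ := by rw [this, add_zero]
    rw [← inner_smul_right, ← inner_smul_right, ← inner_add_right, this, inner_smul_right]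
  have h5 : (A + a) * f y' ≤ (A + a) * f x - a * a * inner ℝ (G x) v +
      M * (A + a) * (a / (A + a) * (a * ‖v‖)) ^ (1 + ν) := by
    have := mul_le_mul_of_nonneg_left h1 hS.le
    refine this.trans (le_of_eq ?_)
    field_simp
    ring
  have h6 : ‖z' - xs‖ ^ 2 = ‖z - xs‖ ^ 2 + 2 * a * inner ℝ v (xs - z) + a ^ 2 * ‖v‖ ^ 2 := by
    have : z' - xs = -((xs - z) + a • v) := by rw [hz']; abel
    rw [this, norm_neg, norm_add_sq_real, inner_smul_right, real_inner_comm, norm_smul,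
      Real.norm_of_nonneg ha.le, norm_sub_rev xs z]
    ring
  have h7 : ‖v‖ ^ 2 = ‖G x‖ ^ 2 + 2 * inner ℝ (G x) (v - G x) + ‖v - G x‖ ^ 2 := by
    rw [← norm_add_sq_real, add_sub_cancel]
  have h8 : inner ℝ (G x) v = ‖G x‖ ^ 2 + inner ℝ (G x) (v - G x) := by
    rw [inner_sub_right, real_inner_self_eq_norm_sq]; ring
  have h9 : inner ℝ v (xs - z) = inner ℝ (v - G x) (xs - z) + inner ℝ (G x) (xs - z) := by
    rw [← inner_add_left, sub_add_cancel]
  have h10 : ‖v‖ ^ 2 ≤ 2 * (‖G x‖ ^ 2 + ‖v - G x‖ ^ 2) := by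
    have : ‖v‖ ≤ ‖G x‖ + ‖v - G x‖ := by simpa using norm_add_le (G x) (v - G x)
    nlinarith [sq_nonneg (‖G x‖ - ‖v - G x‖), norm_nonneg v, norm_nonneg (G x),
      norm_nonneg (v - G x)]
  have h11 := mul_le_mul_of_nonneg_left h2 hA
  have h12 := mul_le_mul_of_nonneg_left h3 ha.le
  have h13 := mul_le_mul_of_nonneg_left h10 (sq_nonneg a)
  rw [h6, h9]
  rw [h8] at h5
  rw [mul_pow] at he
  rw [h7] at h13 he ⊢
  nlinarith

/-! ### Growth of the stepsizes -/

section StepSize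

variable {α ν : ℝ}

lemma stepSize_succ_pos (hα : 0 < α) (k : ℕ) : 0 < stepSize α ν (k + 1) := by
  unfold stepSize; positivity

lemma stepSum_nonneg (hα : 0 < α) (k : ℕ) : 0 ≤ stepSum α ν k := by
  induction k with
  | zero => exact le_rfl
  | succ k ih => exact add_nonneg ih (stepSize_succ_pos hα k).le

lemma stepSum_succ_pos (hα : 0 < α) (k : ℕ) : 0 < stepSum α ν (k + 1) :=
  add_pos_of_nonneg_of_pos (stepSum_nonneg hα k) (stepSize_succ_pos hα k)

lemma rpow_le_self_of_one_le {x s : ℝ} (hx : 1 ≤ x) (hs : s ≤ 1) : x ^ s ≤ x := by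
  simpa using Real.rpow_le_rpow_of_exponent_le hx hs

lemma exponent_nonneg (h0 : 0 ≤ ν) : 0 ≤ 2 * ν / (1 + ν) := by positivity

lemma exponent_le_one (h0 : 0 ≤ ν) (h1 : ν ≤ 1) : 2 * ν / (1 + ν) ≤ 1 := by
  rw [div_le_one (by linarith)]; linarith

/-- As `α_k` grows at most linearly in `k`, `A_k` is at least `k α_{k+1} / 2`. -/
lemma mul_stepSize_succ_le (hα : 0 < α) (h0 : 0 ≤ ν) (h1 : ν ≤ 1) (k : ℕ) :
    k * stepSize α ν (k + 1) ≤ 2 * stepSum α ν k := by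
  induction k with
  | zero => simp [stepSum]
  | succ k ih =>
    have hk : (0 : ℝ) < (k : ℝ) + 1 := by positivity
    have h2 : ((k : ℝ) + 1) * stepSize α ν (k + 1 + 1) ≤ (k + 2) * stepSize α ν (k + 1) := by
      simp only [stepSize]
      push_cast
      have h3 : (((k : ℝ) + 1 + 1) / (k + 1)) ^ (2 * ν / (1 + ν)) ≤ ((k : ℝ) + 1 + 1) / (k + 1) :=
        rpow_le_self_of_one_le (by rw [le_div_iff₀ hk]; linarith) (exponent_le_one h0 h1)
      rw [Real.div_rpow (by positivity) hk.le, div_le_div_iff₀ (by positivity) hk] at h3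
      nlinarith
    rw [stepSum]
    push_cast
    linarith

lemma succ_mul_stepSize_succ_le (hα : 0 < α) (h0 : 0 ≤ ν) (h1 : ν ≤ 1) (k : ℕ) :
    ((k : ℝ) + 1) * stepSize α ν (k + 1) ≤ 2 * stepSum α ν (k + 1) := by
  have := mul_stepSize_succ_le hα h0 h1 k
  have := stepSize_succ_pos (ν := ν) hα k
  rw [stepSum]
  linarith

lemma rpow_le_stepSum (hα : 0 < α) (h0 : 0 ≤ ν) (h1 : ν ≤ 1) {N : ℕ} (hN : 1 ≤ N) :
    α * (N : ℝ) ^ ((1 + 3 * ν) / (1 + ν)) ≤ 2 * stepSum α ν N := by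
  obtain ⟨k, rfl⟩ := Nat.exists_eq_add_of_le' hN
  refine le_trans (le_of_eq ?_) (succ_mul_stepSize_succ_le hα h0 h1 k)
  have h2 : (1 + 3 * ν) / (1 + ν) = 1 + 2 * ν / (1 + ν) := by field_simp; ring
  rw [stepSize, h2, Real.rpow_add (by positivity), Real.rpow_one]
  push_cast
  ring

end StepSize

/-! ### The scaling of the parameters -/

/-- The properties of the parameters that the analysis rests on, with `L` the logarithmic factor
and `C R₀ / (16 L) = √7 R₀ / (16 L)` the clipping parameter. -/
structure Tuned (ν M R₀ α L : ℝ) (N : ℕ) : Prop where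
  radius_pos : 0 < R₀
  step_pos : 0 < α
  two_le_log : 2 ≤ L
  one_le : 1 ≤ N
  /-- On the length scale `128 R₀ L / (k + 1)`, which exceeds `‖x^{k+1} - y^k‖`, the gradient
  varies by little in comparison with the clipping level. -/
  grad_scale : ∀ k < N,
    M * stepSize α ν (k + 1) * (128 * R₀ * L / ((k : ℝ) + 1)) ^ ν ≤ R₀ / (128 * L)
  /-- The Hölder remainder of an iteration is absorbed by the squared step, up to a summable
  error. -/
  remainder : ∀ k < N, ∀ d : ℝ, 0 ≤ d →
    M * stepSum α ν (k + 1) *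
      (stepSize α ν (k + 1) / stepSum α ν (k + 1) * d) ^ (1 + ν) ≤ d ^ 2 / 4 + R₀ ^ 2 / (16 * N)

/-- A power of exponent `1 + ν` is at most a square plus a constant, with any threshold `t`. -/
lemma rpow_one_add_le {ν t d : ℝ} (h0 : 0 ≤ ν) (h1 : ν ≤ 1) (ht : 0 < t) (hd : 0 ≤ d) :
    d ^ (1 + ν) ≤ t ^ (ν - 1) * d ^ 2 + t ^ (1 + ν) := by
  rcases le_total d t with h | h
  · have : d ^ (1 + ν) ≤ t ^ (1 + ν) := Real.rpow_le_rpow hd h (by linarith)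
    have : 0 ≤ t ^ (ν - 1) * d ^ 2 := by positivity
    linarith
  · have hd' : 0 < d := ht.trans_le h
    have h2 : d ^ (ν - 1) ≤ t ^ (ν - 1) := Real.rpow_le_rpow_of_nonpos ht h (by linarith)
    have h3 : d ^ (1 + ν) = d ^ (ν - 1) * d ^ 2 := by
      rw [← Real.rpow_natCast, ← Real.rpow_add hd']; congr 1; push_cast; ring
    have : 0 ≤ t ^ (1 + ν) := by positivity
    rw [h3]
    nlinarith [sq_nonneg d]

/-- The real number whose rounding gives the number of iterations. -/
noncomputable def iterationScale (ν M R₀ ε a : ℝ) : ℝ :=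
  (2 : ℝ) ^ ((1 + ν) / (1 + 3 * ν)) * a ^ ((1 + ν) / (1 + 3 * ν)) *
      C ^ (2 * (1 + ν) / (1 + 3 * ν)) * R₀ ^ (2 * (1 + ν) / (1 + 3 * ν)) *
      M ^ (2 / (1 + 3 * ν)) / ε ^ (2 / (1 + 3 * ν))

section Scaling

variable {ν M R₀ ε a : ℝ}

lemma C_pos : 0 < C := by unfold C; positivity

lemma C_sq : C ^ 2 = 7 := by unfold C; exact Real.sq_sqrt (by norm_num)

lemma stepParam_pos (hM : 0 < M) (hε : 0 < ε) (ha : 0 < a) : 0 < stepParam ν M ε a := by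
  unfold stepParam; positivity

lemma C_rpow_two_mul (r : ℝ) : C ^ (2 * r) = 7 ^ r := by
  rw [Real.rpow_mul C_pos.le]
  norm_num [C_sq]

lemma iterationScale_eq (h0 : 0 ≤ ν) (hM : 0 < M) (hR : 0 < R₀) (hε : 0 < ε) (ha : 0 < a) :
    iterationScale ν M R₀ ε a =
      (14 * a * R₀ ^ 2 * (M / ε) ^ (2 / (1 + ν))) ^ ((1 + ν) / (1 + 3 * ν)) := by
  have hν : 0 < 1 + ν := by linarith
  have h1 : (14 : ℝ) = 2 * 7 := by norm_num
  rw [iterationScale, h1, Real.mul_rpow (by positivity) (by positivity),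
    Real.mul_rpow (by positivity) (by positivity), Real.mul_rpow (by positivity) (by positivity),
    Real.mul_rpow (by positivity) (by positivity), ← Real.rpow_mul (by positivity),
    Real.div_rpow hM.le hε.le, ← Real.rpow_natCast R₀, ← Real.rpow_mul hR.le,
    mul_div_assoc 2 (1 + ν), C_rpow_two_mul]
  have h2 : 2 / (1 + ν) * ((1 + ν) / (1 + 3 * ν)) = 2 / (1 + 3 * ν) := by field_simp
  rw [h2]
  push_cast
  ring

lemma iterationScale_rpow (h0 : 0 ≤ ν) (hM : 0 < M) (hR : 0 < R₀) (hε : 0 < ε) (ha : 0 < a) :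
    iterationScale ν M R₀ ε a ^ ((1 + 3 * ν) / (1 + ν)) =
      14 * a * R₀ ^ 2 * (M / ε) ^ (2 / (1 + ν)) := by
  have hν : 0 < 1 + ν := by linarith
  rw [iterationScale_eq h0 hM hR hε ha, ← Real.rpow_mul (by positivity)]
  have h2 : (1 + ν) / (1 + 3 * ν) * ((1 + 3 * ν) / (1 + ν)) = 1 := by field_simp
  rw [h2, Real.rpow_one]

lemma stepParam_eq (h0 : 0 ≤ ν) (hε : 0 < ε) :
    stepParam ν M ε a = ε ^ ((1 - ν) / (1 + ν)) / (2 * a * M ^ (2 / (1 + ν))) := by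
  have hν : 0 < 1 + ν := by linarith
  have h1 : (2 : ℝ) ^ ((1 - ν) / (1 + ν)) * 2 ^ (2 * ν / (1 + ν)) = 2 := by
    rw [← Real.rpow_add two_pos]
    have : (1 - ν) / (1 + ν) + 2 * ν / (1 + ν) = 1 := by field_simp; ring
    rw [this, Real.rpow_one]
  rw [stepParam, Real.div_rpow hε.le two_pos.le, div_div, ← mul_assoc, ← mul_assoc, h1]

/-- The number of iterations is such that `α N^{(1+3ν)/(1+ν)}` is about `7 R₀² / ε`. -/
lemma stepParam_mul_rpow (h0 : 0 ≤ ν) (hM : 0 < M) (hR : 0 < R₀) (hε : 0 < ε) (ha : 0 < a) :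
    stepParam ν M ε a * iterationScale ν M R₀ ε a ^ ((1 + 3 * ν) / (1 + ν)) =
      7 * R₀ ^ 2 / ε := by
  have hν : 0 < 1 + ν := by linarith
  have h1 : ε ^ (2 / (1 + ν)) = ε * ε ^ ((1 - ν) / (1 + ν)) := by
    nth_rw 2 [← Real.rpow_one ε]
    rw [← Real.rpow_add hε]
    congr 1; field_simp; ring
  rw [iterationScale_rpow h0 hM hR hε ha, stepParam_eq h0 hε, Real.div_rpow hM.le hε.le, h1]
  field_simp
  norm_num

/-- In units of `R₀` and of the number of iterations, `M α` does not involve `ε` and `M`. -/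
lemma const_mul_stepParam (h0 : 0 ≤ ν) (hM : 0 < M) (hR : 0 < R₀) (hε : 0 < ε) (ha : 0 < a) :
    M * stepParam ν M ε a = 1 / (2 * a) * (14 * a * R₀ ^ 2) ^ ((1 - ν) / 2) /
      (iterationScale ν M R₀ ε a ^ ((1 + 3 * ν) / (1 + ν))) ^ ((1 - ν) / 2) := by
  have hν : 0 < 1 + ν := by linarith
  rw [iterationScale_rpow h0 hM hR hε ha, stepParam_eq h0 hε,
    Real.mul_rpow (x := 14 * a * R₀ ^ 2) (by positivity) (by positivity),
    ← Real.rpow_mul (by positivity), Real.div_rpow hM.le hε.le]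
  have h1 : 2 / (1 + ν) * ((1 - ν) / 2) = (1 - ν) / (1 + ν) := by field_simp
  have h2 : M ^ (2 / (1 + ν)) = M * M ^ ((1 - ν) / (1 + ν)) := by
    nth_rw 2 [← Real.rpow_one M]
    rw [← Real.rpow_add hM]
    congr 1; field_simp; ring
  rw [h1, h2]
  field_simp

end Scaling

section Scaling

variable {ν M R₀ ε a L : ℝ}

lemma iterationCount_eq : iterationCount ν M R₀ ε a = ⌈iterationScale ν M R₀ ε a⌉₊ + 1 := rfl

lemma iterationScale_le_count : iterationScale ν M R₀ ε a ≤ iterationCount ν M R₀ ε a := by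
  rw [iterationCount_eq]
  push_cast
  linarith [Nat.le_ceil (iterationScale ν M R₀ ε a)]

lemma count_le_two_mul (hX : 100 ≤ iterationScale ν M R₀ ε a) :
    (iterationCount ν M R₀ ε a : ℝ) ≤ 2 * iterationScale ν M R₀ ε a := by
  have := Nat.ceil_lt_add_one (a := iterationScale ν M R₀ ε a) (by linarith)
  rw [iterationCount_eq]
  push_cast
  linarith

lemma hundred_le_iterationScale (h0 : 0 ≤ ν) (hM : 0 < M) (hR : 0 < R₀) (hε : 0 < ε) (ha : 0 < a)
    (h : ε ≤ (2 : ℝ) ^ ((1 + ν) / 2) * a ^ ((1 + ν) / 2) * C ^ (1 + ν) * R₀ ^ (1 + ν) * M /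
      (100 : ℝ) ^ ((1 + 3 * ν) / 2)) :
    100 ≤ iterationScale ν M R₀ ε a := by
  have hν : 0 < 1 + ν := by linarith
  have hY : (14 * a * R₀ ^ 2 * (M / ε) ^ (2 / (1 + ν))) ^ ((1 + ν) / 2) =
      (2 : ℝ) ^ ((1 + ν) / 2) * a ^ ((1 + ν) / 2) * C ^ (1 + ν) * R₀ ^ (1 + ν) * M / ε := by
    have h1 : (14 : ℝ) = 2 * C ^ 2 := by rw [C_sq]; norm_num
    have hC := C_pos
    have h2 : (C ^ 2) ^ ((1 + ν) / 2) = C ^ (1 + ν) := by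
      rw [← Real.rpow_natCast, ← Real.rpow_mul hC.le]; congr 1; push_cast; ring
    have h3 : (R₀ ^ 2) ^ ((1 + ν) / 2) = R₀ ^ (1 + ν) := by
      rw [← Real.rpow_natCast, ← Real.rpow_mul hR.le]; congr 1; push_cast; ring
    have h4 : 2 / (1 + ν) * ((1 + ν) / 2) = 1 := by field_simp
    rw [h1, Real.mul_rpow (by positivity) (by positivity),
      Real.mul_rpow (by positivity) (by positivity), Real.mul_rpow (by positivity) (by positivity),
      Real.mul_rpow (by positivity) (by positivity), ← Real.rpow_mul (by positivity), h2, h3, h4,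
      Real.rpow_one]
    ring
  have h5 : (100 : ℝ) ^ ((1 + 3 * ν) / 2) ≤
      (14 * a * R₀ ^ 2 * (M / ε) ^ (2 / (1 + ν))) ^ ((1 + ν) / 2) := by
    rw [hY, le_div_iff₀ hε, mul_comm]
    rwa [le_div_iff₀ (by positivity)] at h
  have h6 := Real.rpow_le_rpow (z := 2 / (1 + 3 * ν)) (by positivity) h5 (by positivity)
  rw [← Real.rpow_mul (by norm_num), ← Real.rpow_mul (by positivity)] at h6
  have h7 : (1 + 3 * ν) / 2 * (2 / (1 + 3 * ν)) = 1 := by field_simp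
  have h8 : (1 + ν) / 2 * (2 / (1 + 3 * ν)) = (1 + ν) / (1 + 3 * ν) := by field_simp
  rw [h7, h8, Real.rpow_one] at h6
  rwa [iterationScale_eq h0 hM hR hε ha]

/-- `M α_k` in units of `R₀`; the exponents combine to the negative power `(1 - ν) / 2` of the
iteration scale `X`. -/
lemma const_mul_stepSize_le (h0 : 0 ≤ ν) (h1 : ν ≤ 1) (hM : 0 < M) (hR : 0 < R₀) (hε : 0 < ε)
    (ha : 0 < a) {X : ℝ} (hX : X = iterationScale ν M R₀ ε a) (hX1 : 100 ≤ X) {k : ℕ}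
    (hk : ((k : ℝ) + 1) ≤ 2 * X) :
    M * stepSize (stepParam ν M ε a) ν (k + 1) ≤
      ((k : ℝ) + 1) ^ ν * R₀ ^ (1 - ν) * ((14 * a) ^ ((1 - ν) / 2) / (a * X ^ ((1 - ν) / 2))) := by
  have hν : 0 < 1 + ν := by linarith
  have hX0 : 0 < X := by linarith
  have hκ : (0 : ℝ) < (k : ℝ) + 1 := by positivity
  have hd : 2 * ν / (1 + ν) - ν = ν * (1 - ν) / (1 + ν) := by field_simp; ring
  have hd0 : 0 ≤ 2 * ν / (1 + ν) - ν := by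
    rw [hd]; exact div_nonneg (mul_nonneg h0 (by linarith)) hν.le
  have hd1 : 2 * ν / (1 + ν) - ν ≤ 1 := by linarith [exponent_le_one h0 h1]
  have h2 : ((k : ℝ) + 1) ^ (2 * ν / (1 + ν) - ν) ≤ 2 * X ^ (2 * ν / (1 + ν) - ν) :=
    calc _ ≤ (2 * X) ^ (2 * ν / (1 + ν) - ν) := Real.rpow_le_rpow hκ.le hk hd0
      _ = 2 ^ (2 * ν / (1 + ν) - ν) * X ^ (2 * ν / (1 + ν) - ν) :=
        Real.mul_rpow (by norm_num) hX0.le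
      _ ≤ _ := by
        gcongr
        exact rpow_le_self_of_one_le (by norm_num) hd1
  have h3 : ((k : ℝ) + 1) ^ (2 * ν / (1 + ν)) =
      ((k : ℝ) + 1) ^ ν * ((k : ℝ) + 1) ^ (2 * ν / (1 + ν) - ν) := by
    rw [← Real.rpow_add hκ]; congr 1; ring
  have h4 : (R₀ ^ 2) ^ ((1 - ν) / 2) = R₀ ^ (1 - ν) := by
    rw [← Real.rpow_natCast, ← Real.rpow_mul hR.le]; congr 1; push_cast; ring
  have h5 : (X ^ ((1 + 3 * ν) / (1 + ν))) ^ ((1 - ν) / 2) =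
      X ^ (2 * ν / (1 + ν) - ν) * X ^ ((1 - ν) / 2) := by
    rw [← Real.rpow_mul hX0.le, ← Real.rpow_add hX0]; congr 1; field_simp; ring
  rw [stepSize, ← mul_assoc, const_mul_stepParam h0 hM hR hε ha, ← hX, h5, h3,
    Real.mul_rpow (by positivity) (by positivity), h4]
  calc _ = ((k : ℝ) + 1) ^ ν * R₀ ^ (1 - ν) *
        ((14 * a) ^ ((1 - ν) / 2) / (a * X ^ ((1 - ν) / 2))) *
        (((k : ℝ) + 1) ^ (2 * ν / (1 + ν) - ν) / (2 * X ^ (2 * ν / (1 + ν) - ν))) := by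
          field_simp
    _ ≤ ((k : ℝ) + 1) ^ ν * R₀ ^ (1 - ν) *
        ((14 * a) ^ ((1 - ν) / 2) / (a * X ^ ((1 - ν) / 2))) * 1 := by
      gcongr
      rwa [div_le_one (by positivity)]
    _ = _ := mul_one _

lemma a_rpow_le (h0 : 0 ≤ ν) (hL : 2 ≤ L) (ha : 16384 * L ^ 2 ≤ a) :
    a ^ ((1 - ν) / 2) / a * (128 * L) ^ (1 + ν) ≤ 1 := by
  have ha0 : 0 < a := by nlinarith
  have h1 : (128 * L) ^ (1 + ν) ≤ a ^ ((1 + ν) / 2) := by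
    calc (128 * L) ^ (1 + ν) = ((128 * L) ^ 2) ^ ((1 + ν) / 2) := by
          rw [← Real.rpow_natCast, ← Real.rpow_mul (by positivity)]; congr 1; push_cast; ring
      _ ≤ _ := Real.rpow_le_rpow (by positivity) (by nlinarith) (by linarith)
  calc _ ≤ a ^ ((1 - ν) / 2) / a * a ^ ((1 + ν) / 2) := by gcongr
    _ = a ^ ((1 - ν) / 2) * a ^ ((1 + ν) / 2) / a := by ring
    _ = 1 := by
      rw [← Real.rpow_add ha0]
      have : (1 - ν) / 2 + (1 + ν) / 2 = 1 := by ring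
      rw [this, Real.rpow_one, div_self ha0.ne']

/-- The admissible parameters are tuned: the requirement `a ≥ (128 L)²` pays for all numerical
constants, once the unrounded iteration count is so large that rounding at most doubles it. -/
theorem tuned_stepParam {N : ℕ} (h0 : 0 ≤ ν) (h1 : ν ≤ 1) (hM : 0 < M) (hR : 0 < R₀) (hε : 0 < ε)
    (hL : 2 ≤ L) (ha : 16384 * L ^ 2 ≤ a) (hX1 : 100 ≤ iterationScale ν M R₀ ε a)
    (hN : N = iterationCount ν M R₀ ε a) : Tuned ν M R₀ (stepParam ν M ε a) L N := by
  have ha0 : 0 < a := by nlinarith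
  have hα := stepParam_pos (ν := ν) hM hε ha0
  obtain ⟨X, hX⟩ : ∃ X, X = iterationScale ν M R₀ ε a := ⟨_, rfl⟩
  rw [← hX] at hX1
  have hX0 : 0 < X := by linarith
  have hNX : (N : ℝ) ≤ 2 * X := by rw [hN, hX]; exact count_le_two_mul (hX ▸ hX1)
  have hN1 : 1 ≤ N := by rw [hN, iterationCount_eq]; omega
  have hN0 : (0 : ℝ) < N := by exact_mod_cast hN1
  have hk : ∀ k < N, ((k : ℝ) + 1) ≤ 2 * X := fun k hk =>
    le_trans (by exact_mod_cast hk) hNX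
  set K := (14 * a) ^ ((1 - ν) / 2) / (a * X ^ ((1 - ν) / 2)) with hK
  have hK0 : 0 < K := by positivity
  have hF : ∀ k < N, M * stepSize (stepParam ν M ε a) ν (k + 1) ≤
      ((k : ℝ) + 1) ^ ν * R₀ ^ (1 - ν) * K := fun k hkN =>
    const_mul_stepSize_le h0 h1 hM hR hε ha0 hX hX1 (hk k hkN)
  have hKX : K = (14 / X) ^ ((1 - ν) / 2) * (a ^ ((1 - ν) / 2) / a) := by
    rw [hK, Real.mul_rpow (by norm_num) ha0.le, Real.div_rpow (by norm_num) hX0.le]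
    field_simp
  have haν := a_rpow_le h0 hL ha
  have hK1 : K * (128 * L) ^ (1 + ν) ≤ 1 := by
    have : (14 / X) ^ ((1 - ν) / 2) ≤ 1 := by
      apply Real.rpow_le_one (by positivity) _ (by linarith)
      rw [div_le_one hX0]; linarith
    rw [hKX, mul_assoc]
    calc _ ≤ 1 * (1 : ℝ) := by gcongr
      _ = 1 := one_mul 1
  have hK2 : K * X ^ ((1 - ν) / 2) ≤ 1 / 64 := by
    have h14 : (14 : ℝ) ^ ((1 - ν) / 2) ≤ 4 := by
      calc (14 : ℝ) ^ ((1 - ν) / 2) ≤ 16 ^ ((1 : ℝ) / 2) := by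
            refine (Real.rpow_le_rpow (by norm_num) (by norm_num : (14 : ℝ) ≤ 16)
              (by linarith)).trans (Real.rpow_le_rpow_of_exponent_le (by norm_num) (by linarith))
        _ = 4 := by
          rw [show (16 : ℝ) = 4 ^ (2 : ℝ) by norm_num, ← Real.rpow_mul (by norm_num)]; norm_num
    have h256 : 256 ≤ (128 * L) ^ (1 + ν) := by
      calc (256 : ℝ) ≤ 128 * L := by linarith
        _ = (128 * L) ^ (1 : ℝ) := (Real.rpow_one _).symm
        _ ≤ _ := Real.rpow_le_rpow_of_exponent_le (by linarith) (by linarith)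
    have h4 : 0 ≤ a ^ ((1 - ν) / 2) / a := by positivity
    have h5 : K * X ^ ((1 - ν) / 2) = 14 ^ ((1 - ν) / 2) * (a ^ ((1 - ν) / 2) / a) := by
      rw [hKX, Real.div_rpow (by norm_num) hX0.le]; field_simp
    rw [h5]
    nlinarith
  refine ⟨hR, hα, hL, hN1, fun k hkN => ?_, fun k hkN d hd => ?_⟩
  · have hκ : (0 : ℝ) < (k : ℝ) + 1 := by positivity
    have h2 : (128 * R₀ * L / ((k : ℝ) + 1)) ^ ν =
        (128 * L) ^ ν * R₀ ^ ν / ((k : ℝ) + 1) ^ ν := by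
      rw [Real.div_rpow (by positivity) hκ.le, ← Real.mul_rpow (by positivity) hR.le]
      congr 2; ring
    have h3 : R₀ ^ (1 - ν) * R₀ ^ ν = R₀ := by
      rw [← Real.rpow_add hR, sub_add_cancel, Real.rpow_one]
    have h4 : (128 * L) ^ (1 + ν) = 128 * L * (128 * L) ^ ν := by
      rw [Real.rpow_add (by positivity), Real.rpow_one]
    rw [h4] at hK1
    calc _ ≤ ((k : ℝ) + 1) ^ ν * R₀ ^ (1 - ν) * K *
          ((128 * L) ^ ν * R₀ ^ ν / ((k : ℝ) + 1) ^ ν) := by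
          rw [h2]; exact mul_le_mul_of_nonneg_right (hF k hkN) (by positivity)
      _ = (R₀ ^ (1 - ν) * R₀ ^ ν) * (K * (128 * L) ^ ν) := by field_simp
      _ ≤ R₀ * (1 / (128 * L)) := by
        rw [h3]
        gcongr
        rw [le_div_iff₀ (by positivity)]
        linarith
      _ = _ := by ring
  · have hκ : (0 : ℝ) < (k : ℝ) + 1 := by positivity
    set s := stepSize (stepParam ν M ε a) ν (k + 1) with hs
    set A := stepSum (stepParam ν M ε a) ν (k + 1) with hA
    have hs0 : 0 < s := stepSize_succ_pos hα k
    have hA0 : 0 < A := stepSum_succ_pos hα k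
    have hsA : s / A ≤ 2 / ((k : ℝ) + 1) := by
      rw [div_le_div_iff₀ hA0 hκ]
      have := succ_mul_stepSize_succ_le hα h0 h1 k
      rw [← hs, ← hA] at this
      linarith
    have hcoef : M * A * (s / A) ^ (1 + ν) ≤ 2 * R₀ ^ (1 - ν) * K := by
      calc M * A * (s / A) ^ (1 + ν) = M * s * (s / A) ^ ν := by
            rw [Real.rpow_add (by positivity), Real.rpow_one]; field_simp
        _ ≤ ((k : ℝ) + 1) ^ ν * R₀ ^ (1 - ν) * K * (2 / ((k : ℝ) + 1)) ^ ν :=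
            mul_le_mul (hF k hkN) (Real.rpow_le_rpow (by positivity) hsA h0) (by positivity)
              (by positivity)
        _ = 2 ^ ν * R₀ ^ (1 - ν) * K := by
            rw [Real.div_rpow (by norm_num) hκ.le]; field_simp
        _ ≤ 2 * R₀ ^ (1 - ν) * K := by
            gcongr
            exact rpow_le_self_of_one_le (by norm_num) h1
    -- the threshold `R₀ / √X` balances the two parts of the remainder over `N ≈ X` iterations
    have ht : 0 < R₀ * X ^ (-(1 / 2) : ℝ) := by positivity
    have h2 := rpow_one_add_le h0 h1 ht hd
    have h3 : (R₀ * X ^ (-(1 / 2) : ℝ)) ^ (ν - 1) = R₀ ^ (ν - 1) * X ^ ((1 - ν) / 2) := by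
      rw [Real.mul_rpow hR.le (by positivity), ← Real.rpow_mul hX0.le]; congr 2; ring
    have h4 : (R₀ * X ^ (-(1 / 2) : ℝ)) ^ (1 + ν) = R₀ ^ (1 + ν) * X ^ ((1 - ν) / 2) / X := by
      rw [Real.mul_rpow hR.le (by positivity), ← Real.rpow_mul hX0.le, mul_div_assoc,
        ← Real.rpow_sub_one hX0.ne']
      congr 2; ring
    have h5 : R₀ ^ (1 - ν) * R₀ ^ (ν - 1) = 1 := by
      rw [← Real.rpow_add hR]; simp
    have h6 : R₀ ^ (1 - ν) * R₀ ^ (1 + ν) = R₀ ^ 2 := by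
      rw [← Real.rpow_add hR, ← Real.rpow_natCast]; congr 1; push_cast; ring
    rw [h3, h4] at h2
    calc M * A * (s / A * d) ^ (1 + ν) = M * A * (s / A) ^ (1 + ν) * d ^ (1 + ν) := by
          rw [Real.mul_rpow (by positivity) hd]; ring
      _ ≤ 2 * R₀ ^ (1 - ν) * K * (R₀ ^ (ν - 1) * X ^ ((1 - ν) / 2) * d ^ 2 +
          R₀ ^ (1 + ν) * X ^ ((1 - ν) / 2) / X) := by gcongr
      _ = 2 * (K * X ^ ((1 - ν) / 2)) * ((R₀ ^ (1 - ν) * R₀ ^ (ν - 1)) * d ^ 2) +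
          2 * (K * X ^ ((1 - ν) / 2)) * ((R₀ ^ (1 - ν) * R₀ ^ (1 + ν)) / X) := by ring
      _ ≤ 2 * (1 / 64) * (1 * d ^ 2) + 2 * (1 / 64) * (R₀ ^ 2 / X) := by
          rw [h5, h6]; gcongr
      _ ≤ d ^ 2 / 4 + R₀ ^ 2 / (16 * N) := by
          have h7 : R₀ ^ 2 / (2 * X) ≤ R₀ ^ 2 / N := by gcongr
          have h8 : R₀ ^ 2 / (2 * X) = R₀ ^ 2 / X / 2 := by field_simp
          have h9 : R₀ ^ 2 / (16 * N) = R₀ ^ 2 / N / 16 := by field_simp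
          rw [h9]
          nlinarith [sq_nonneg d]

end Scaling

/-! ### The trajectory as long as the accumulated noise is small -/

lemma C_le : C ≤ 8 / 3 := by
  have := C_sq
  have := C_pos
  nlinarith

lemma le_C : 5 / 2 ≤ C := by
  have := C_sq
  have := C_pos
  nlinarith

/-- The gradient at the query point is at most half the clipping level. The gradient at `y` is
bounded through the function gap with a step of length `t = 128 R₀ L / (k + 1)`; when this step
would leave the ball, the Hölder condition between the query point and the minimizer suffices. -/
theorem LocallyHolder.stepSize_mul_norm_le {n : ℕ} {f : Space n → ℝ} {G : Space n → Space n}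
    {xs : Space n} {ν M R₀ α L : ℝ} {N : ℕ} (h : LocallyHolder f G xs ν M R₀)
    (T : Tuned ν M R₀ α L N) {k : ℕ} (hk : k < N) {s : State n} (hy : ‖s.y - xs‖ ≤ C * R₀)
    (hz : ‖s.z - xs‖ ≤ C * R₀) (hgap : stepSum α ν k * (f s.y - f xs) ≤ 7 / 2 * R₀ ^ 2) :
    stepSize α ν (k + 1) * ‖G (queryPoint α ν k s)‖ ≤ C * R₀ / (16 * L) / 2 := by
  have hR := T.radius_pos
  have hL := T.two_le_log
  have hM := h.const_pos
  have hC := C_le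
  have hC' := le_C
  have hs := stepSize_succ_pos (ν := ν) T.step_pos k
  have hA := stepSum_succ_pos (ν := ν) T.step_pos k
  have hκ : (0 : ℝ) < (k : ℝ) + 1 := by positivity
  have hR3 : C * R₀ ≤ 3 * R₀ := by gcongr; linarith
  have hCball : Metric.closedBall xs (C * R₀) ⊆ Metric.closedBall xs (3 * R₀) :=
    Metric.closedBall_subset_closedBall hR3
  have hy' : s.y ∈ Metric.closedBall xs (C * R₀) := mem_closedBall_iff_norm.2 hy
  have hz' : s.z ∈ Metric.closedBall xs (C * R₀) := mem_closedBall_iff_norm.2 hz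
  have hx' : queryPoint α ν k s ∈ Metric.closedBall xs (C * R₀) :=
    mix_mem_closedBall (stepSum_nonneg T.step_pos k) hs hy' hz'
  have hxs : xs ∈ Metric.closedBall xs (3 * R₀) := Metric.mem_closedBall_self (by positivity)
  have hg := T.grad_scale k hk
  obtain ⟨t, ht⟩ : ∃ t, t = 128 * R₀ * L / ((k : ℝ) + 1) := ⟨_, rfl⟩
  have ht0 : 0 < t := by rw [ht]; positivity
  rw [← ht] at hg
  have hgoal : C * R₀ / (16 * L) / 2 = 4 * C * (R₀ / (128 * L)) := by field_simp; norm_num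
  have hunit : 0 < R₀ / (128 * L) := by positivity
  rw [hgoal]
  obtain ⟨x, hx⟩ : ∃ x, x = queryPoint α ν k s := ⟨_, rfl⟩
  rw [← hx] at hx' ⊢
  -- the step stays in the ball of radius `3 R₀` if `t ≤ R₀ / 3`, as `√7 ≤ 8 / 3`; this forces
  -- `k + 1 ≥ 768`, so that `(k + 1) / k` is close to one
  rcases le_total t (R₀ / 3) with hc | hc
  · have hκ1 : 768 ≤ (k : ℝ) + 1 := by
      rw [ht, div_le_iff₀ hκ] at hc
      have : R₀ * (384 * L) ≤ R₀ * (k + 1) := by linarith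
      linarith [le_of_mul_le_mul_left this hR]
    have hk0 : (0 : ℝ) < k := by linarith
    have h1 : t * ‖G s.y‖ ≤ f s.y - f xs + M * t ^ (1 + ν) :=
      h.mul_norm_le ht0.le (by
        have : C * R₀ ≤ 8 / 3 * R₀ := by gcongr
        linarith)
    have h2 : ‖x - s.y‖ ≤ t := by
      have e1 : x - s.y = (stepSize α ν (k + 1) / stepSum α ν (k + 1)) • (s.z - s.y) := by
        rw [hx, queryPoint]
        have e2 : s.y = (1 / stepSum α ν (k + 1)) • (stepSum α ν (k + 1) • s.y) := by
          rw [smul_smul, one_div_mul_cancel hA.ne', one_smul]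
        nth_rw 2 [e2]
        rw [← smul_sub, show stepSize α ν (k + 1) / stepSum α ν (k + 1) =
          1 / stepSum α ν (k + 1) * stepSize α ν (k + 1) by ring, mul_smul]
        congr 1
        rw [stepSum]
        module
      have e3 : ‖s.z - s.y‖ ≤ 2 * (C * R₀) := by
        have : s.z - s.y = (s.z - xs) - (s.y - xs) := by abel
        rw [this]
        linarith [norm_sub_le (s.z - xs) (s.y - xs)]
      have e4 : stepSize α ν (k + 1) / stepSum α ν (k + 1) ≤ 2 / ((k : ℝ) + 1) := by
        rw [div_le_div_iff₀ hA hκ]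
        linarith [succ_mul_stepSize_succ_le T.step_pos h.nonneg h.le_one k]
      rw [e1, norm_smul, Real.norm_of_nonneg (by positivity), ht]
      calc _ ≤ 2 / ((k : ℝ) + 1) * (2 * (C * R₀)) := by gcongr
        _ = (4 * C) * R₀ / ((k : ℝ) + 1) := by ring
        _ ≤ (128 * L) * R₀ / ((k : ℝ) + 1) :=
          div_le_div_of_nonneg_right (mul_le_mul_of_nonneg_right (by linarith) hR.le) hκ.le
        _ = _ := by ring
    have h3 : ‖G x‖ ≤ ‖G s.y‖ + M * t ^ ν :=
      (h.norm_grad_le (hCball hx') (hCball hy')).trans (by gcongr; exact h.nonneg)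
    have h4 : stepSize α ν (k + 1) * (f s.y - f xs) ≤ 7 * R₀ ^ 2 / k := by
      rw [le_div_iff₀ hk0]
      have e1 := mul_le_mul_of_nonneg_right
        (mul_stepSize_succ_le T.step_pos h.nonneg h.le_one k) (sub_nonneg.2 (h.min_le s.y))
      linarith
    have h5 : stepSize α ν (k + 1) * ‖G s.y‖ ≤
        7 * R₀ ^ 2 / k / t + M * stepSize α ν (k + 1) * t ^ ν := by
      have e1 : t ^ (1 + ν) = t * t ^ ν := by rw [Real.rpow_add ht0, Real.rpow_one]
      rw [e1] at h1
      have e2 : 7 * R₀ ^ 2 / k / t * t = 7 * R₀ ^ 2 / k := div_mul_cancel₀ _ ht0.ne'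
      refine le_of_mul_le_mul_right ?_ ht0
      rw [add_mul, e2]
      calc _ = stepSize α ν (k + 1) * (t * ‖G s.y‖) := by ring
        _ ≤ stepSize α ν (k + 1) * (f s.y - f xs + M * (t * t ^ ν)) := by gcongr
        _ ≤ _ := by linarith
    have h6 : 7 * R₀ ^ 2 / k / t ≤ 8 * (R₀ / (128 * L)) := by
      rw [ht]
      have : 7 * R₀ ^ 2 / k / (128 * R₀ * L / ((k : ℝ) + 1)) =
          (7 * ((k : ℝ) + 1) / k) * (R₀ / (128 * L)) := by field_simp
      rw [this]
      gcongr
      rw [div_le_iff₀ hk0]; linarith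
    calc _ ≤ stepSize α ν (k + 1) * (‖G s.y‖ + M * t ^ ν) := by gcongr
      _ ≤ 10 * (R₀ / (128 * L)) := by linarith
      _ ≤ _ := by gcongr; linarith
  · have h1 : ‖G x‖ ≤ M * ‖x - xs‖ ^ ν := by
      simpa [h.grad_min] using h.norm_grad_le (hCball hx') hxs
    have h2 : ‖x - xs‖ ^ ν ≤ 8 * t ^ ν := by
      calc ‖x - xs‖ ^ ν ≤ (8 * t) ^ ν := by
            refine Real.rpow_le_rpow (norm_nonneg _) ?_ h.nonneg
            have := mem_closedBall_iff_norm.1 hx'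
            have : C * R₀ ≤ 8 / 3 * R₀ := by gcongr
            linarith
        _ = 8 ^ ν * t ^ ν := Real.mul_rpow (by norm_num) ht0.le
        _ ≤ _ := by gcongr; exact rpow_le_self_of_one_le (by norm_num) h.le_one
    calc _ ≤ stepSize α ν (k + 1) * (M * (8 * t ^ ν)) := by
            have := h1.trans (mul_le_mul_of_nonneg_left h2 hM.le)
            gcongr
      _ = 8 * (M * stepSize α ν (k + 1) * t ^ ν) := by ring
      _ ≤ 8 * (R₀ / (128 * L)) := by gcongr
      _ ≤ _ := by gcongr; linarith

section Trajectory

variable {n : ℕ} {Ξ : Type*}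

/-- What the gradient error `th = clip(∇f(x, ξ)) - G x` of an iteration with stepsize `a` and
clipping level `l` adds to the energy: `a ⟨th, x* - z⟩ + a² ‖th‖²`. -/
noncomputable def noiseTerm (g : Space n → Ξ → Space n) (G : Space n → Space n) (xs : Space n)
    (a l : ℝ) (m : ℕ) (x z : Space n) (b : ℕ → Ξ) : ℝ :=
  a * inner ℝ (clip (miniBatch g x m b) l - G x) (xs - z) +
    a ^ 2 * ‖clip (miniBatch g x m b) l - G x‖ ^ 2

/-- The points at which the noise of an iteration with stepsize `a` and clipping level `B / a` is
under control: `z` is in the ball of radius `√7 R₀` and the gradient at the query point `x` is at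
most half the clipping level. -/
def Controlled (G : Space n → Space n) (xs : Space n) (R₀ a B : ℝ) (x z : Space n) : Prop :=
  ‖z - xs‖ ≤ C * R₀ ∧ a * ‖G x‖ ≤ B / 2

open Classical in
/-- The accumulated noise along the trajectory, frozen as soon as it exceeds `5 R₀² / 2` and not
increased by iterations at points that are not controlled. -/
noncomputable def stoppedNoise (g : Space n → Ξ → Space n) (G : Space n → Space n) (xs : Space n)
    (α ν R₀ B : ℝ) (m : ℕ → ℕ) (x0 : Space n) (ξ : ℕ → ℕ → Ξ) : ℕ → ℝ
  | 0 => 0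
  | k + 1 =>
    let V := stoppedNoise g G xs α ν R₀ B m x0 ξ k
    let s := iterate g α ν B m x0 ξ k
    let x := queryPoint α ν k s
    V + if V ≤ 5 / 2 * R₀ ^ 2 ∧ Controlled G xs R₀ (stepSize α ν (k + 1)) B x s.z then
      noiseTerm g G xs (stepSize α ν (k + 1)) (clipLevel α ν B (k + 1)) (m k) x s.z (ξ k) else 0

variable {g : Space n → Ξ → Space n} {f : Space n → ℝ} {G : Space n → Space n}
    {xs x0 : Space n} {ν M R₀ α B L : ℝ} {m : ℕ → ℕ} {ξ : ℕ → ℕ → Ξ} {N : ℕ}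

lemma stoppedNoise_le_of_le {k j : ℕ} (hkj : k ≤ j)
    (h : stoppedNoise g G xs α ν R₀ B m x0 ξ j ≤ 5 / 2 * R₀ ^ 2) :
    stoppedNoise g G xs α ν R₀ B m x0 ξ k ≤ 5 / 2 * R₀ ^ 2 := by
  induction j, hkj using Nat.le_induction with
  | base => exact h
  | succ j _ ih =>
    apply ih
    by_contra hj
    apply hj
    rw [stoppedNoise, if_neg (fun h => hj h.1), add_zero] at h
    exact h

/-- If the stopped noise never exceeds its threshold, the iterates stay in the ball of radius
`√7 R₀`, every iteration is controlled, and the energy is at most `7 R₀² / 2`. -/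
theorem energy_le (h : LocallyHolder f G xs ν M R₀) (T : Tuned ν M R₀ α L N)
    (hB : B = C * R₀ / (16 * L)) (hx0 : ‖x0 - xs‖ ≤ R₀)
    (hV : stoppedNoise g G xs α ν R₀ B m x0 ξ N ≤ 5 / 2 * R₀ ^ 2) {k : ℕ} (hk : k ≤ N) :
    ‖(iterate g α ν B m x0 ξ k).y - xs‖ ≤ C * R₀ ∧
      stepSum α ν k * (f (iterate g α ν B m x0 ξ k).y - f xs) +
        ‖(iterate g α ν B m x0 ξ k).z - xs‖ ^ 2 / 2 ≤
      R₀ ^ 2 / 2 + stoppedNoise g G xs α ν R₀ B m x0 ξ k + k * (R₀ ^ 2 / (16 * N)) := by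
  have hR := T.radius_pos
  have hC := C_le
  have hC' := le_C
  have hL := T.two_le_log
  have hN : (0 : ℝ) < N := by exact_mod_cast T.one_le
  have hR2 := sq_nonneg R₀
  have hB0 : 0 < B := by rw [hB]; have := C_pos; positivity
  have hrem : ∀ j ≤ N, (j : ℝ) * (R₀ ^ 2 / (16 * N)) ≤ R₀ ^ 2 / 16 := fun j hj => by
    have : (j : ℝ) ≤ N := by exact_mod_cast hj
    calc (j : ℝ) * (R₀ ^ 2 / (16 * N)) ≤ N * (R₀ ^ 2 / (16 * N)) := by gcongr
      _ = _ := by field_simp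
  have hball : ∀ {w : Space n}, ‖w‖ ^ 2 / 2 ≤ 7 / 2 * R₀ ^ 2 → ‖w‖ ≤ C * R₀ := fun {w} hw => by
    have h1 : (C * R₀) ^ 2 = 7 * R₀ ^ 2 := by rw [mul_pow, C_sq]
    exact le_of_sq_le_sq (by linarith) (by positivity)
  induction k with
  | zero =>
    refine ⟨hx0.trans ?_, ?_⟩
    · nlinarith
    · simp only [iterate, stepSum, stoppedNoise]
      have : ‖x0 - xs‖ ^ 2 ≤ R₀ ^ 2 := by gcongr
      push_cast
      linarith
  | succ k ih =>
    obtain ⟨hy, hE⟩ := ih (by omega)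
    have hVk := stoppedNoise_le_of_le (by omega : k ≤ N) hV
    have hVk1 := stoppedNoise_le_of_le hk hV
    have hrk := hrem k (by omega)
    have hrk1 := hrem (k + 1) hk
    have hA0 := stepSum_nonneg (ν := ν) T.step_pos k
    have hA1 := stepSum_succ_pos (ν := ν) T.step_pos k
    have hs := stepSize_succ_pos (ν := ν) T.step_pos k
    obtain ⟨s, hsdef⟩ : ∃ s, s = iterate g α ν B m x0 ξ k := ⟨_, rfl⟩
    rw [← hsdef] at hy hE
    obtain ⟨s', hs'⟩ : ∃ s', s' = iterate g α ν B m x0 ξ (k + 1) := ⟨_, rfl⟩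
    rw [← hs']
    obtain ⟨v, hv⟩ : ∃ v, v = clip (miniBatch g (queryPoint α ν k s) (m k) (ξ k))
      (clipLevel α ν B (k + 1)) := ⟨_, rfl⟩
    have hz' : s'.z = s.z - stepSize α ν (k + 1) • v := by
      rw [hs', iterate, hv, hsdef]; rfl
    have hy' : s'.y = (1 / (stepSum α ν k + stepSize α ν (k + 1))) •
        (stepSum α ν k • s.y + stepSize α ν (k + 1) • s'.z) := by
      rw [hs', hsdef, iterate]; rfl
    have hgap : 0 ≤ stepSum α ν k * (f s.y - f xs) :=
      mul_nonneg hA0 (sub_nonneg.2 (h.min_le _))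
    have hz : ‖s.z - xs‖ ≤ C * R₀ := hball (by linarith)
    have hctrl : stepSize α ν (k + 1) * ‖G (queryPoint α ν k s)‖ ≤ B / 2 := by
      rw [hB]
      exact h.stepSize_mul_norm_le T (by omega) hy hz (by linarith [sq_nonneg ‖s.z - xs‖])
    have hVeq : stoppedNoise g G xs α ν R₀ B m x0 ξ (k + 1) =
        stoppedNoise g G xs α ν R₀ B m x0 ξ k +
        (stepSize α ν (k + 1) * inner ℝ (v - G (queryPoint α ν k s)) (xs - s.z) +
          stepSize α ν (k + 1) ^ 2 * ‖v - G (queryPoint α ν k s)‖ ^ 2) := by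
      rw [stoppedNoise, if_pos, noiseTerm, hv, hsdef]
      rw [← hsdef]
      exact ⟨hVk, hz, hctrl⟩
    have hl0 : 0 ≤ clipLevel α ν B (k + 1) := div_nonneg hB0.le hs.le
    have hvB : stepSize α ν (k + 1) * ‖v‖ ≤ B := by
      calc _ ≤ stepSize α ν (k + 1) * clipLevel α ν B (k + 1) := by
            rw [hv]; gcongr; exact norm_clip_le _ hl0
        _ = B := by rw [clipLevel]; field_simp
    have hBR : B ≤ R₀ / 3 := by
      rw [hB, div_le_div_iff₀ (by positivity) (by norm_num)]
      nlinarith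
    have hy3 : s.y ∈ Metric.closedBall xs (3 * R₀) := by
      rw [mem_closedBall_iff_norm]; nlinarith
    have hz3 : s.z ∈ Metric.closedBall xs (3 * R₀) := by
      rw [mem_closedBall_iff_norm]; nlinarith
    have hz3' : s'.z ∈ Metric.closedBall xs (3 * R₀) := by
      rw [mem_closedBall_iff_norm, hz']
      have e1 : s.z - stepSize α ν (k + 1) • v - xs =
        (s.z - xs) - stepSize α ν (k + 1) • v := by abel
      have e2 := norm_sub_le (s.z - xs) (stepSize α ν (k + 1) • v)
      rw [norm_smul, Real.norm_of_nonneg hs.le] at e2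
      rw [e1]
      nlinarith
    have hxm : queryPoint α ν k s ∈ Metric.closedBall xs (3 * R₀) :=
      mix_mem_closedBall hA0 hs hy3 hz3
    have hym : s'.y ∈ Metric.closedBall xs (3 * R₀) := by
      rw [hy']; exact mix_mem_closedBall hA0 hs hy3 hz3'
    have hstep := h.energy_step hA0 hs (x := queryPoint α ν k s) rfl hz' hy' hxm hym
      (T.remainder k (by omega) _ (by positivity))
    have hE' : stepSum α ν (k + 1) * (f s'.y - f xs) + ‖s'.z - xs‖ ^ 2 / 2 ≤
        R₀ ^ 2 / 2 + stoppedNoise g G xs α ν R₀ B m x0 ξ (k + 1) +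
          ((k + 1 : ℕ) : ℝ) * (R₀ ^ 2 / (16 * N)) := by
      rw [hVeq]
      rw [stepSum]
      push_cast
      linarith
    refine ⟨?_, hE'⟩
    have hgap' : 0 ≤ stepSum α ν (k + 1) * (f s'.y - f xs) :=
      mul_nonneg hA1.le (sub_nonneg.2 (h.min_le _))
    have hzC : s'.z ∈ Metric.closedBall xs (C * R₀) :=
      mem_closedBall_iff_norm.2 (hball (by linarith))
    rw [← mem_closedBall_iff_norm, hy']
    exact mix_mem_closedBall hA0 hs (mem_closedBall_iff_norm.2 hy) hzC

/-- The function gap of the output when the stopped noise stays below its threshold. -/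
theorem gap_le_of_stoppedNoise_le (h : LocallyHolder f G xs ν M R₀) (T : Tuned ν M R₀ α L N)
    (hB : B = C * R₀ / (16 * L)) (hx0 : ‖x0 - xs‖ ≤ R₀)
    (hV : stoppedNoise g G xs α ν R₀ B m x0 ξ N ≤ 5 / 2 * R₀ ^ 2) :
    f (iterate g α ν B m x0 ξ N).y - f xs ≤
      7 * R₀ ^ 2 / (α * (N : ℝ) ^ ((1 + 3 * ν) / (1 + ν))) := by
  have hα := T.step_pos
  have hN : (0 : ℝ) < N := by exact_mod_cast T.one_le
  have h1 := (energy_le h T hB hx0 hV le_rfl).2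
  have h2 : (N : ℝ) * (R₀ ^ 2 / (16 * N)) = R₀ ^ 2 / 16 := by field_simp
  rw [h2] at h1
  have h3 := mul_le_mul_of_nonneg_right (rpow_le_stepSum hα h.nonneg h.le_one T.one_le)
    (sub_nonneg.2 (h.min_le (iterate g α ν B m x0 ξ N).y))
  rw [le_div_iff₀ (by positivity)]
  nlinarith [sq_nonneg ‖(iterate g α ν B m x0 ξ N).z - xs‖, sq_nonneg R₀]

end Trajectory

/-! ### Moments of the noise of one iteration -/

section Pointwise

variable {n : ℕ} {Ξ : Type*} {g : Space n → Ξ → Space n} {G : Space n → Space n}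
  {xs x z : Space n} {R₀ L a B : ℝ} {m : ℕ} {b : ℕ → Ξ}

/-- Pointwise bounds of the noise term `Y` in terms of the batch error `e`. Clipping at `B / a` does
not increase the error, and its bias is quadratic in `e`; hence `Y` exceeds a term of mean zero by
`O(‖e‖²)` only, and `Y²` is `O(‖e‖²)`. -/
lemma noiseTerm_bounds (hR : 0 < R₀) (hL : 2 ≤ L) (ha : 0 < a) (hB : B = C * R₀ / (16 * L))
    (hc : Controlled G xs R₀ a B x z) :
    L * |noiseTerm g G xs a (B / a) m x z b| ≤ 2 * R₀ ^ 2 ∧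
    noiseTerm g G xs a (B / a) m x z b ≤ a * inner ℝ (miniBatch g x m b - G x) (xs - z) +
      (8 * L + 1) * (a ^ 2 * ‖miniBatch g x m b - G x‖ ^ 2) ∧
    noiseTerm g G xs a (B / a) m x z b ^ 2 ≤
      8 * R₀ ^ 2 * (a ^ 2 * ‖miniBatch g x m b - G x‖ ^ 2) := by
  have hC := C_le
  have hC0 := C_pos
  have hC2 := C_sq
  have hB0 : 0 < B := by rw [hB]; positivity
  obtain ⟨hz, hGx⟩ := hc
  have hl0 : 0 < B / a := by positivity
  have hGl : ‖G x‖ ≤ B / a / 2 := by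
    rw [div_div, le_div_iff₀ (by positivity)]; linarith
  have hw : ‖xs - z‖ ≤ C * R₀ := by rwa [norm_sub_rev]
  obtain ⟨e, he⟩ : ∃ e, e = miniBatch g x m b - G x := ⟨_, rfl⟩
  obtain ⟨v, hv⟩ : ∃ v, v = clip (miniBatch g x m b) (B / a) := ⟨_, rfl⟩
  obtain ⟨w, hwdef⟩ : ∃ w, w = xs - z := ⟨_, rfl⟩
  have h1 : ‖v - G x‖ ≤ ‖e‖ := by
    rw [hv, he]; exact norm_clip_sub_le _ (hGl.trans (by linarith))
  have h2 : ‖v - miniBatch g x m b‖ ≤ ‖e‖ ^ 2 / (2 * (B / a)) := by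
    rw [hv, he]; exact norm_clip_sub_self_le _ hl0 hGl
  have h3 : a * ‖v - G x‖ ≤ 3 / 2 * B := by
    have e1 : ‖v‖ ≤ B / a := by rw [hv]; exact norm_clip_le _ hl0.le
    rw [le_div_iff₀ ha] at e1
    have e2 := mul_le_mul_of_nonneg_left (norm_sub_le v (G x)) ha.le
    linarith
  rw [noiseTerm, ← hv, ← he, ← hwdef]
  rw [← hwdef] at hw
  have hBR : B ≤ C * R₀ / 32 := by
    rw [hB, div_le_div_iff₀ (by positivity) (by norm_num)]
    have : 0 < C * R₀ := by positivity
    nlinarith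
  have hBL : B * L = C * R₀ / 16 := by rw [hB]; field_simp
  obtain ⟨r, hr⟩ : ∃ r, r = a * ‖v - G x‖ := ⟨_, rfl⟩
  have hr0 : 0 ≤ r := by rw [hr]; positivity
  obtain ⟨Y, hY⟩ : ∃ Y, Y = a * inner ℝ (v - G x) w + a ^ 2 * ‖v - G x‖ ^ 2 := ⟨_, rfl⟩
  rw [← hY]
  have hCR : 0 < C * R₀ := by positivity
  have hYabs : |Y| ≤ r * (21 / 20 * (C * R₀)) := by
    have e1 : |a * inner ℝ (v - G x) w| ≤ r * (C * R₀) := by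
      rw [abs_mul, abs_of_pos ha, hr, mul_assoc]
      exact mul_le_mul_of_nonneg_left ((abs_real_inner_le_norm _ _).trans (by gcongr)) ha.le
    have e2 : a ^ 2 * ‖v - G x‖ ^ 2 = r * r := by rw [hr]; ring
    rw [hY, e2]
    refine (abs_add_le _ _).trans ?_
    rw [abs_of_nonneg (mul_nonneg hr0 hr0)]
    have : r * r ≤ r * (1 / 20 * (C * R₀)) := by
      gcongr
      rw [hr]
      linarith
    linarith
  have hCR2 : (C * R₀) ^ 2 = 7 * R₀ ^ 2 := by rw [mul_pow, hC2]
  have hYL : L * |Y| ≤ 2 * R₀ ^ 2 := by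
    have e2 : r * (21 / 20 * (C * R₀)) ≤ 3 / 2 * B * (21 / 20 * (C * R₀)) := by
      gcongr
      rw [hr]; exact h3
    calc L * |Y| ≤ L * (3 / 2 * B * (21 / 20 * (C * R₀))) := by
          gcongr; exact hYabs.trans e2
      _ = 63 / 40 * (B * L) * (C * R₀) := by ring
      _ = 63 / 640 * (C * R₀) ^ 2 := by rw [hBL]; ring
      _ ≤ _ := by rw [hCR2]; linarith [sq_nonneg R₀]
  have hre : r ≤ a * ‖e‖ := by rw [hr]; gcongr
  have hY1 : Y ≤ a * inner ℝ e w + (8 * L + 1) * (a ^ 2 * ‖e‖ ^ 2) := by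
    have e1 : inner ℝ (v - G x) w = inner ℝ e w + inner ℝ (v - miniBatch g x m b) w := by
      rw [← inner_add_left, he]; congr 1; abel
    have e2 : inner ℝ (v - miniBatch g x m b) w ≤ ‖e‖ ^ 2 / (2 * (B / a)) * (C * R₀) :=
      (real_inner_le_norm _ _).trans (by gcongr)
    have e3 : a * (‖e‖ ^ 2 / (2 * (B / a)) * (C * R₀)) = 8 * L * (a ^ 2 * ‖e‖ ^ 2) := by
      rw [hB]; field_simp; ring
    have e4 : a ^ 2 * ‖v - G x‖ ^ 2 ≤ a ^ 2 * ‖e‖ ^ 2 := by gcongr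
    have e5 := mul_le_mul_of_nonneg_left e2 ha.le
    rw [hY, e1]
    linarith
  have hY2 : Y ^ 2 ≤ 8 * R₀ ^ 2 * (a ^ 2 * ‖e‖ ^ 2) := by
    calc Y ^ 2 = |Y| ^ 2 := (sq_abs Y).symm
      _ ≤ (a * ‖e‖ * (21 / 20 * (C * R₀))) ^ 2 := by
        gcongr
        exact hYabs.trans (by gcongr)
      _ = 441 / 400 * (C * R₀) ^ 2 * (a ^ 2 * ‖e‖ ^ 2) := by ring
      _ ≤ _ := by
        rw [hCR2]
        exact mul_le_mul_of_nonneg_right (by linarith [sq_nonneg R₀]) (by positivity)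
  exact ⟨hYL, hY1, hY2⟩

/-- Pointwise bound of the exponential noise by an affine function of the batch error and a
multiple of its square. -/
lemma exp_noiseTerm_le (hR : 0 < R₀) (hL : 2 ≤ L) (ha : 0 < a) (hB : B = C * R₀ / (16 * L))
    (hc : Controlled G xs R₀ a B x z) :
    Real.exp (L / (2 * R₀ ^ 2) * noiseTerm g G xs a (B / a) m x z b) ≤
      1 + (L / (2 * R₀ ^ 2) * a) * inner ℝ (miniBatch g x m b - G x) (xs - z) +
        8 * L ^ 2 / R₀ ^ 2 * a ^ 2 * ‖miniBatch g x m b - G x‖ ^ 2 := by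
  obtain ⟨hYL, hY1, hY2⟩ := noiseTerm_bounds (g := g) (m := m) (b := b) hR hL ha hB hc
  obtain ⟨Y, hY⟩ : ∃ Y, Y = noiseTerm g G xs a (B / a) m x z b := ⟨_, rfl⟩
  obtain ⟨e, he⟩ : ∃ e, e = miniBatch g x m b - G x := ⟨_, rfl⟩
  rw [← hY] at hYL
  rw [← hY, ← he] at hY1 hY2 ⊢
  have hs0 : 0 < L / (2 * R₀ ^ 2) := by positivity
  have hsmall : |L / (2 * R₀ ^ 2) * Y| ≤ 1 := by
    rwa [abs_mul, abs_of_pos hs0, div_mul_eq_mul_div, div_le_one (by positivity)]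
  have hexp : Real.exp (L / (2 * R₀ ^ 2) * Y) ≤
      1 + L / (2 * R₀ ^ 2) * Y + (L / (2 * R₀ ^ 2) * Y) ^ 2 := by
    have := (abs_le.1 (Real.abs_exp_sub_one_sub_id_le hsmall)).2
    linarith
  refine hexp.trans ?_
  have hfin : L / (2 * R₀ ^ 2) * (8 * L + 1) + (L / (2 * R₀ ^ 2)) ^ 2 * (8 * R₀ ^ 2) ≤
      8 * L ^ 2 / R₀ ^ 2 := by
    have : L / (2 * R₀ ^ 2) * (8 * L + 1) + (L / (2 * R₀ ^ 2)) ^ 2 * (8 * R₀ ^ 2) =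
      (6 * L ^ 2 + L / 2) / R₀ ^ 2 := by field_simp; ring
    rw [this]
    gcongr
    have : 2 * L ≤ L * L := by gcongr
    linarith
  have e6 := mul_le_mul_of_nonneg_left hY1 hs0.le
  have e7 := mul_le_mul_of_nonneg_left hY2 (sq_nonneg (L / (2 * R₀ ^ 2)))
  have e8 := mul_le_mul_of_nonneg_right hfin (by positivity : 0 ≤ a ^ 2 * ‖e‖ ^ 2)
  rw [mul_pow]
  linarith


end Pointwise

section Moments

variable {n : ℕ} {Ξ : Type*} [MeasurableSpace Ξ] {P : Measure Ξ}
  {g : Space n → Ξ → Space n} {G : Space n → Space n} {σ : ℝ}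
  {Ω : Type*} [MeasurableSpace Ω] {μ : Measure Ω} {ζ : ℕ → Ω → Ξ}

lemma integral_comp_of_map_eq {X : Type*} [NormedAddCommGroup X] [NormedSpace ℝ X] {u : Ω → Ξ}
    (hu : Measurable u) (hlaw : μ.map u = P) {φ : Ξ → X} (hφ : Integrable φ P) :
    Integrable (fun ω => φ (u ω)) μ ∧ ∫ ω, φ (u ω) ∂μ = ∫ s, φ s ∂P := by
  subst hlaw
  exact ⟨hφ.comp_measurable hu, (integral_map hu.aemeasurable hφ.1).symm⟩

variable [IsProbabilityMeasure μ]

/-- The variance of the mean of `m` independent samples is at most `σ² / m`. -/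
theorem integral_norm_miniBatch_sub_sq_le (hg : Measurable (Function.uncurry g)) {x : Space n}
    (hint : Integrable (g x) P) (hmean : ∫ s, g x s ∂P = G x) [IsProbabilityMeasure P]
    (hint2 : Integrable (fun s => ‖g x s - G x‖ ^ 2) P)
    (hvar : ∫ s, ‖g x s - G x‖ ^ 2 ∂P ≤ σ ^ 2)
    (hζ : ∀ i, Measurable (ζ i)) (hlaw : ∀ i, μ.map (ζ i) = P) (hind : iIndepFun ζ μ)
    {m : ℕ} (hm : 1 ≤ m) :
    Integrable (fun ω => miniBatch g x m (fun i => ζ i ω) - G x) μ ∧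
      ∫ ω, (miniBatch g x m (fun i => ζ i ω) - G x) ∂μ = 0 ∧
      Integrable (fun ω => ‖miniBatch g x m (fun i => ζ i ω) - G x‖ ^ 2) μ ∧
      ∫ ω, ‖miniBatch g x m (fun i => ζ i ω) - G x‖ ^ 2 ∂μ ≤ σ ^ 2 / m := by
  have hgx : Measurable (g x) := hg.comp measurable_prodMk_left
  obtain ⟨X, hX⟩ : ∃ X : ℕ → Ω → Space n, X = fun i ω => g x (ζ i ω) - G x := ⟨_, rfl⟩
  have hXi : ∀ i, Integrable (X i) μ ∧ ∫ ω, X i ω ∂μ = 0 := fun i => by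
    have := integral_comp_of_map_eq (hζ i) (hlaw i) (hint.sub (integrable_const (G x)))
    rw [hX]
    refine ⟨this.1, this.2.trans ?_⟩
    simp only [Pi.sub_apply]
    rw [integral_sub hint (integrable_const _), hmean]
    simp
  have hX2 : ∀ i, Integrable (fun ω => ‖X i ω‖ ^ 2) μ ∧ ∫ ω, ‖X i ω‖ ^ 2 ∂μ ≤ σ ^ 2 := fun i => by
    have := integral_comp_of_map_eq (hζ i) (hlaw i) hint2
    rw [hX]
    exact ⟨this.1, this.2.le.trans hvar⟩
  have hcross : ∀ i j, i ≠ j →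
      Integrable (fun ω => inner ℝ (X i ω) (X j ω)) μ ∧ ∫ ω, inner ℝ (X i ω) (X j ω) ∂μ = 0 := by
    intro i j hij
    have hI : IndepFun (X i) (X j) μ := by
      have := (hind.indepFun hij).comp (hgx.sub_const (G x)) (hgx.sub_const (G x))
      rw [hX]
      exact this
    constructor
    · refine Integrable.mono' ((hX2 i).1.add (hX2 j).1)
        ((hXi i).1.aestronglyMeasurable.inner (hXi j).1.aestronglyMeasurable)
        (Filter.Eventually.of_forall fun ω => ?_)
      have := norm_inner_le_norm (𝕜 := ℝ) (X i ω) (X j ω)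
      simp only [Pi.add_apply]
      nlinarith [sq_nonneg (‖X i ω‖ - ‖X j ω‖), sq_nonneg ‖X i ω‖, sq_nonneg ‖X j ω‖]
    · have := hI.integral_bilin (hXi i).1 (hXi j).1 (innerSL ℝ)
      rw [(hXi i).2, map_zero] at this
      exact this
  have hS : ∀ k : ℕ, Integrable (fun ω => ‖∑ i ∈ Finset.range k, X i ω‖ ^ 2) μ ∧
      ∫ ω, ‖∑ i ∈ Finset.range k, X i ω‖ ^ 2 ∂μ ≤ k * σ ^ 2 := by
    intro k
    induction k with
    | zero => simp
    | succ k ih =>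
      have hexp : (fun ω => ‖∑ i ∈ Finset.range (k + 1), X i ω‖ ^ 2) = fun ω =>
          ‖∑ i ∈ Finset.range k, X i ω‖ ^ 2 +
            2 * (∑ i ∈ Finset.range k, inner ℝ (X i ω) (X k ω)) + ‖X k ω‖ ^ 2 := by
        ext ω
        rw [Finset.sum_range_succ, norm_add_sq_real, sum_inner]
      have hc1 : Integrable (fun ω => ∑ i ∈ Finset.range k, inner ℝ (X i ω) (X k ω)) μ :=
        integrable_finsetSum _ fun i hi =>
          (hcross i k (Finset.mem_range.1 hi).ne).1
      have hc2 : ∫ ω, ∑ i ∈ Finset.range k, inner ℝ (X i ω) (X k ω) ∂μ = 0 := by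
        rw [integral_finsetSum _ fun i hi => (hcross i k (Finset.mem_range.1 hi).ne).1]
        exact Finset.sum_eq_zero fun i hi => (hcross i k (Finset.mem_range.1 hi).ne).2
      rw [hexp]
      refine ⟨(ih.1.add (hc1.const_mul 2)).add (hX2 k).1, ?_⟩
      have e1 := integral_add (ih.1.add (hc1.const_mul 2)) (hX2 k).1
      simp only [Pi.add_apply] at e1
      rw [e1, integral_add ih.1 (hc1.const_mul 2), integral_const_mul, hc2]
      push_cast
      linarith [ih.2, (hX2 k).2]
  have hm0 : (0 : ℝ) < m := by exact_mod_cast hm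
  have hbatch : ∀ ω, miniBatch g x m (fun i => ζ i ω) - G x =
      (1 / (m : ℝ)) • ∑ i ∈ Finset.range m, X i ω := by
    intro ω
    rw [hX, miniBatch]
    simp only [Finset.sum_sub_distrib, Finset.sum_const, Finset.card_range]
    rw [smul_sub, ← Nat.cast_smul_eq_nsmul ℝ, smul_smul, one_div_mul_cancel hm0.ne', one_smul]
  have hsum : Integrable (fun ω => ∑ i ∈ Finset.range m, X i ω) μ :=
    integrable_finsetSum _ fun i _ => (hXi i).1
  have hsq : ∀ ω, ‖(1 / (m : ℝ)) • ∑ i ∈ Finset.range m, X i ω‖ ^ 2 =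
      (1 / (m : ℝ)) ^ 2 * ‖∑ i ∈ Finset.range m, X i ω‖ ^ 2 := fun ω => by
    rw [norm_smul, mul_pow, Real.norm_of_nonneg (by positivity)]
  simp only [hbatch, hsq]
  refine ⟨hsum.smul (1 / (m : ℝ)), ?_, (hS m).1.const_mul _, ?_⟩
  · rw [integral_smul, integral_finsetSum _ fun i _ => (hXi i).1,
      Finset.sum_eq_zero fun i _ => (hXi i).2, smul_zero]
  · rw [integral_const_mul]
    calc _ ≤ (1 / (m : ℝ)) ^ 2 * (m * σ ^ 2) := by gcongr; exact (hS m).2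
      _ = _ := by field_simp

/-- Exponential moment of the noise of one iteration at a controlled point. -/
theorem lintegral_exp_noiseTerm_le (hg : Measurable (Function.uncurry g)) {xs x z : Space n}
    [IsProbabilityMeasure P] (hint : Integrable (g x) P) (hmean : ∫ s, g x s ∂P = G x)
    (hint2 : Integrable (fun s => ‖g x s - G x‖ ^ 2) P)
    (hvar : ∫ s, ‖g x s - G x‖ ^ 2 ∂P ≤ σ ^ 2)
    (hζ : ∀ i, Measurable (ζ i)) (hlaw : ∀ i, μ.map (ζ i) = P) (hind : iIndepFun ζ μ)
    {m N : ℕ} (hm : 1 ≤ m) (hN : 1 ≤ N) {R₀ L a B : ℝ} (hR : 0 < R₀) (hL : 2 ≤ L) (ha : 0 < a)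
    (hB : B = C * R₀ / (16 * L)) (hc : Controlled G xs R₀ a B x z)
    (hsize : 20736 * N * σ ^ 2 * a ^ 2 * L / (C ^ 2 * R₀ ^ 2) ≤ m) :
    ∫⁻ ω, ENNReal.ofReal (Real.exp (L / (2 * R₀ ^ 2) *
        noiseTerm g G xs a (B / a) m x z (fun i => ζ i ω))) ∂μ ≤
      ENNReal.ofReal (Real.exp (L / (4 * N))) := by
  obtain ⟨hi1, hi2, hi3, hi4⟩ :=
    integral_norm_miniBatch_sub_sq_le hg hint hmean hint2 hvar hζ hlaw hind hm
  have hm0 : (0 : ℝ) < m := by exact_mod_cast hm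
  have hN0 : (0 : ℝ) < N := by exact_mod_cast hN
  have hii : Integrable (fun ω =>
      inner ℝ (miniBatch g x m (fun i => ζ i ω) - G x) (xs - z)) μ := hi1.inner_const _
  have hii0 : ∫ ω, inner ℝ (miniBatch g x m (fun i => ζ i ω) - G x) (xs - z) ∂μ = 0 := by
    have := integral_inner (𝕜 := ℝ) hi1 (xs - z)
    rw [hi2, inner_zero_right] at this
    simpa only [real_inner_comm] using this
  have hI := ((integrable_const (μ := μ) (1 : ℝ)).add
    (hii.const_mul (L / (2 * R₀ ^ 2) * a))).add (hi3.const_mul (8 * L ^ 2 / R₀ ^ 2 * a ^ 2))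
  calc _ ≤ ∫⁻ ω, ENNReal.ofReal (1 +
          (L / (2 * R₀ ^ 2) * a) * inner ℝ (miniBatch g x m (fun i => ζ i ω) - G x) (xs - z) +
          8 * L ^ 2 / R₀ ^ 2 * a ^ 2 * ‖miniBatch g x m (fun i => ζ i ω) - G x‖ ^ 2) ∂μ :=
        lintegral_mono fun ω => ENNReal.ofReal_le_ofReal (exp_noiseTerm_le hR hL ha hB hc)
    _ = ENNReal.ofReal (∫ ω, (1 +
          (L / (2 * R₀ ^ 2) * a) * inner ℝ (miniBatch g x m (fun i => ζ i ω) - G x) (xs - z) +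
          8 * L ^ 2 / R₀ ^ 2 * a ^ 2 * ‖miniBatch g x m (fun i => ζ i ω) - G x‖ ^ 2) ∂μ) :=
        (ofReal_integral_eq_lintegral_ofReal hI (Filter.Eventually.of_forall fun ω =>
          (Real.exp_pos _).le.trans (exp_noiseTerm_le hR hL ha hB hc))).symm
    _ ≤ _ := ENNReal.ofReal_le_ofReal ?_
  have e1 := integral_add ((integrable_const (μ := μ) (1 : ℝ)).add
    (hii.const_mul (L / (2 * R₀ ^ 2) * a))) (hi3.const_mul (8 * L ^ 2 / R₀ ^ 2 * a ^ 2))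
  have e2 := integral_add (integrable_const (μ := μ) (1 : ℝ))
    (hii.const_mul (L / (2 * R₀ ^ 2) * a))
  simp only [Pi.add_apply] at e1
  rw [e1, e2, integral_const_mul, integral_const_mul, hii0]
  simp only [integral_const, probReal_univ, smul_eq_mul, mul_one, mul_zero, add_zero]
  have e3 : 8 * L ^ 2 / R₀ ^ 2 * a ^ 2 * (σ ^ 2 / m) ≤ L / (4 * N) := by
    rw [C_sq, div_le_iff₀ (by positivity)] at hsize
    have e4 : 8 * L ^ 2 / R₀ ^ 2 * a ^ 2 * (σ ^ 2 / m) =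
      8 * L ^ 2 * a ^ 2 * σ ^ 2 / (R₀ ^ 2 * m) := by field_simp
    rw [e4, div_le_div_iff₀ (by positivity) (by positivity)]
    have e5 := mul_le_mul_of_nonneg_left hsize (by positivity : 0 ≤ L)
    have e6 : 0 ≤ L ^ 2 * a ^ 2 * σ ^ 2 * N := by positivity
    have e7 : 0 ≤ L * (m * R₀ ^ 2) := by positivity
    linarith
  have e8 : 8 * L ^ 2 / R₀ ^ 2 * a ^ 2 *
      ∫ ω, ‖miniBatch g x m (fun i => ζ i ω) - G x‖ ^ 2 ∂μ ≤ L / (4 * N) :=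
    (mul_le_mul_of_nonneg_left hi4 (by positivity)).trans e3
  linarith [Real.add_one_le_exp (L / (4 * N))]

end Moments

/-! ### The exponential moment of the accumulated noise -/

section Measurability

variable {n : ℕ} {Ξ : Type*} [MeasurableSpace Ξ] {g : Space n → Ξ → Space n}
  {G : Space n → Space n} {xs x0 : Space n} {α ν R₀ B : ℝ} {m : ℕ → ℕ}

lemma measurable_miniBatch (hg : Measurable (Function.uncurry g)) (m : ℕ) :
    Measurable fun p : Space n × (ℕ → Ξ) => miniBatch g p.1 m p.2 := by
  unfold miniBatch
  have h : Measurable fun p : Space n × (ℕ → Ξ) => ∑ i ∈ Finset.range m, g p.1 (p.2 i) :=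
    Finset.measurable_fun_sum _ fun i _ =>
      hg.comp (measurable_fst.prodMk ((measurable_pi_apply i).comp measurable_snd))
  exact h.const_smul (1 / (m : ℝ))

lemma measurable_mix {Ω : Type*} {_ : MeasurableSpace Ω} {u v : Ω → Space n} (hu : Measurable u)
    (hv : Measurable v) (a b c : ℝ) : Measurable fun ω => c • (a • u ω + b • v ω) := by
  fun_prop

/-- The increment of the stopped noise as a function of the accumulated noise, the query point, the
point `z` and the batch. -/
noncomputable def stoppedTerm (g : Space n → Ξ → Space n) (G : Space n → Space n) (xs : Space n)
    (α ν R₀ B : ℝ) (m : ℕ → ℕ) (k : ℕ) (p : (ℝ × Space n × Space n) × (ℕ → Ξ)) : ℝ :=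
  open Classical in
  if p.1.1 ≤ 5 / 2 * R₀ ^ 2 ∧ Controlled G xs R₀ (stepSize α ν (k + 1)) B p.1.2.1 p.1.2.2 then
    noiseTerm g G xs (stepSize α ν (k + 1)) (clipLevel α ν B (k + 1)) (m k) p.1.2.1 p.1.2.2 p.2
  else 0

lemma measurable_stoppedTerm (hg : Measurable (Function.uncurry g)) (hG : Measurable G) (k : ℕ) :
    Measurable (stoppedTerm g G xs α ν R₀ B m k) := by
  unfold stoppedTerm
  refine Measurable.ite ?_ ?_ measurable_const
  · have h1 : Measurable fun p : (ℝ × Space n × Space n) × (ℕ → Ξ) => p.1.1 := by fun_prop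
    have h2 : Measurable fun p : (ℝ × Space n × Space n) × (ℕ → Ξ) => ‖p.1.2.2 - xs‖ := by
      fun_prop
    have h3 : Measurable fun p : (ℝ × Space n × Space n) × (ℕ → Ξ) =>
        stepSize α ν (k + 1) * ‖G p.1.2.1‖ := by fun_prop
    exact (h1 measurableSet_Iic).inter ((h2 measurableSet_Iic).inter (h3 measurableSet_Iic))
  · unfold noiseTerm
    have h1 : Measurable fun p : (ℝ × Space n × Space n) × (ℕ → Ξ) =>
        clip (miniBatch g p.1.2.1 (m k) p.2) (clipLevel α ν B (k + 1)) - G p.1.2.1 :=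
      ((measurable_clip _).comp ((measurable_miniBatch hg (m k)).comp
        ((measurable_fst.comp (measurable_snd.comp measurable_fst)).prodMk
          measurable_snd))).sub (by fun_prop)
    have h2 : Measurable fun p : (ℝ × Space n × Space n) × (ℕ → Ξ) => xs - p.1.2.2 := by fun_prop
    exact ((h1.inner h2).const_mul _).add ((h1.norm.pow_const 2).const_mul _)

omit [MeasurableSpace Ξ] in
lemma iterate_succ_y (ξ : ℕ → ℕ → Ξ) (k : ℕ) :
    (iterate g α ν B m x0 ξ (k + 1)).y = (1 / stepSum α ν (k + 1)) •
      (stepSum α ν k • (iterate g α ν B m x0 ξ k).y +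
        stepSize α ν (k + 1) • (iterate g α ν B m x0 ξ (k + 1)).z) := by
  simp only [iterate]

omit [MeasurableSpace Ξ] in
lemma iterate_succ_z (ξ : ℕ → ℕ → Ξ) (k : ℕ) :
    (iterate g α ν B m x0 ξ (k + 1)).z = (iterate g α ν B m x0 ξ k).z - stepSize α ν (k + 1) •
      clip (miniBatch g (queryPoint α ν k (iterate g α ν B m x0 ξ k)) (m k) (ξ k))
        (clipLevel α ν B (k + 1)) := by
  simp only [iterate, nextZ]

omit [MeasurableSpace Ξ] in
lemma stoppedNoise_succ (ξ : ℕ → ℕ → Ξ) (k : ℕ) :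
    stoppedNoise g G xs α ν R₀ B m x0 ξ (k + 1) = stoppedNoise g G xs α ν R₀ B m x0 ξ k +
      stoppedTerm g G xs α ν R₀ B m k ((stoppedNoise g G xs α ν R₀ B m x0 ξ k,
        queryPoint α ν k (iterate g α ν B m x0 ξ k), (iterate g α ν B m x0 ξ k).z), ξ k) := by
  simp only [stoppedNoise, stoppedTerm]

/-- The iterates and the stopped noise depend measurably on the samples of the iterations so
far; the `σ`-algebra is arbitrary, so that the one generated by these samples can be used. -/
lemma measurable_history (hg : Measurable (Function.uncurry g)) (hG : Measurable G)
    {Ω : Type*} {_ : MeasurableSpace Ω} {ξ : ℕ → ℕ → Ω → Ξ} (k : ℕ)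
    (hξ : ∀ j < k, ∀ i, Measurable (ξ j i)) :
    Measurable (fun ω => (iterate g α ν B m x0 (fun j i => ξ j i ω) k).y) ∧
    Measurable (fun ω => (iterate g α ν B m x0 (fun j i => ξ j i ω) k).z) ∧
    Measurable (fun ω => stoppedNoise g G xs α ν R₀ B m x0 (fun j i => ξ j i ω) k) := by
  induction k with
  | zero => exact ⟨measurable_const, measurable_const, measurable_const⟩
  | succ k ih =>
    obtain ⟨hy, hz, hV⟩ := ih fun j hj => hξ j (by omega)
    have hb : Measurable fun ω i => ξ k i ω := measurable_pi_lambda _ fun i => hξ k (by omega) i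
    have hx : Measurable fun ω =>
        queryPoint α ν k (iterate g α ν B m x0 (fun j i => ξ j i ω) k) :=
      measurable_mix hy hz (stepSum α ν k) (stepSize α ν (k + 1)) (1 / stepSum α ν (k + 1))
    have hz' : Measurable fun ω => (iterate g α ν B m x0 (fun j i => ξ j i ω) (k + 1)).z := by
      have hv : Measurable fun ω => clip (miniBatch g (queryPoint α ν k
          (iterate g α ν B m x0 (fun j i => ξ j i ω) k)) (m k) (fun i => ξ k i ω))
          (clipLevel α ν B (k + 1)) := by
        have hq := (measurable_miniBatch hg (m k)).comp (hx.prodMk hb)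
        exact (measurable_clip _).comp hq
      simp only [iterate_succ_z]
      exact hz.sub (hv.const_smul (stepSize α ν (k + 1)))
    have hy' : Measurable fun ω => (iterate g α ν B m x0 (fun j i => ξ j i ω) (k + 1)).y := by
      simp only [iterate_succ_y]
      exact measurable_mix hy hz' (stepSum α ν k) (stepSize α ν (k + 1))
        (1 / stepSum α ν (k + 1))
    have hV' : Measurable fun ω =>
        stoppedNoise g G xs α ν R₀ B m x0 (fun j i => ξ j i ω) (k + 1) := by
      have ht := (measurable_stoppedTerm (xs := xs) (α := α) (ν := ν) (R₀ := R₀) (B := B) (m := m)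
        hg hG k).comp ((hV.prodMk (hx.prodMk hz)).prodMk hb)
      simp only [stoppedNoise_succ]
      exact hV.add ht
    exact ⟨hy', hz', hV'⟩

end Measurability

section Moment

variable {n : ℕ} {Ξ : Type*} [MeasurableSpace Ξ] {P : Measure Ξ} [IsProbabilityMeasure P]
  {g : Space n → Ξ → Space n} {G : Space n → Space n} {xs x0 : Space n} {α ν R₀ σ L B : ℝ}
  {m : ℕ → ℕ} {N : ℕ} {Ω : Type*} [MeasurableSpace Ω] {μ : Measure Ω}
  {ξ : ℕ → ℕ → Ω → Ξ}

/-- The batch of iteration `k` is independent of everything that happened before. -/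
lemma indepFun_history (hg : Measurable (Function.uncurry g)) (hG : Measurable G)
    (hξ : ∀ k i, Measurable (ξ k i)) (hindep : iIndepFun (fun p : ℕ × ℕ => ξ p.1 p.2) μ) (k : ℕ) :
    IndepFun
      (fun ω => (stoppedNoise g G xs α ν R₀ B m x0 (fun j i => ξ j i ω) k,
        queryPoint α ν k (iterate g α ν B m x0 (fun j i => ξ j i ω) k),
        (iterate g α ν B m x0 (fun j i => ξ j i ω) k).z))
      (fun ω i => ξ k i ω) μ := by
  have hdisj : Disjoint {p : ℕ × ℕ | p.1 < k} {p : ℕ × ℕ | p.1 = k} := by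
    rw [Set.disjoint_left]
    intro p hp hp'
    simp only [Set.mem_ofPred_eq] at hp hp'
    omega
  have hI := indep_iSup_of_disjoint (fun p : ℕ × ℕ => (hξ p.1 p.2).comap_le) hindep hdisj
  rw [IndepFun_iff_Indep]
  refine indep_of_indep_of_le_left (indep_of_indep_of_le_right hI ?_) ?_
  · refine Measurable.comap_le ?_
    refine @measurable_pi_lambda _ _ _ (_) _ _ fun i => ?_
    refine Measurable.of_comap_le ?_
    exact le_iSup₂_of_le (f := fun (p : ℕ × ℕ) (_ : p ∈ {p : ℕ × ℕ | p.1 = k}) =>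
      MeasurableSpace.comap (ξ p.1 p.2) inferInstance) (k, i) rfl le_rfl
  · refine Measurable.comap_le ?_
    have hm : ∀ j < k, ∀ i, Measurable[⨆ p ∈ {p : ℕ × ℕ | p.1 < k},
        MeasurableSpace.comap (ξ p.1 p.2) inferInstance] (ξ j i) := fun j hj i =>
      Measurable.of_comap_le
        (le_iSup₂_of_le (f := fun (p : ℕ × ℕ) (_ : p ∈ {p : ℕ × ℕ | p.1 < k}) =>
          MeasurableSpace.comap (ξ p.1 p.2) inferInstance) (j, i) hj le_rfl)
    obtain ⟨hy, hz, hV⟩ := measurable_history (xs := xs) (x0 := x0) (α := α) (ν := ν) (R₀ := R₀)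
      (B := B) (m := m) hg hG k hm
    refine @Measurable.prodMk _ _ _ _ _ (_) _ _ hV (@Measurable.prodMk _ _ _ _ _ (_) _ _
      (measurable_mix hy hz _ _ _) hz)

variable [IsProbabilityMeasure μ]

/-- Each iteration multiplies the exponential moment of the stopped noise by at most
`exp (L / (4N))`: condition on the history by Fubini's theorem. -/
theorem lintegral_exp_stoppedNoise_succ_le (hg : Measurable (Function.uncurry g))
    (hint : ∀ x, Integrable (g x) P) (hmean : ∀ x, ∫ s, g x s ∂P = G x)
    (hint2 : ∀ x, Integrable (fun s => ‖g x s - G x‖ ^ 2) P)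
    (hvar : ∀ x, ∫ s, ‖g x s - G x‖ ^ 2 ∂P ≤ σ ^ 2)
    (hξ : ∀ k i, Measurable (ξ k i)) (hlaw : ∀ k i, μ.map (ξ k i) = P)
    (hindep : iIndepFun (fun p : ℕ × ℕ => ξ p.1 p.2) μ)
    (hG : Measurable G) (hN : 1 ≤ N) (hR : 0 < R₀) (hL : 2 ≤ L) (hα : 0 < α)
    (hB : B = C * R₀ / (16 * L)) {k : ℕ} (hm : 1 ≤ m k)
    (hsize : 20736 * N * σ ^ 2 * stepSize α ν (k + 1) ^ 2 * L / (C ^ 2 * R₀ ^ 2) ≤ m k) :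
    ∫⁻ ω, ENNReal.ofReal (Real.exp (L / (2 * R₀ ^ 2) *
        stoppedNoise g G xs α ν R₀ B m x0 (fun j i => ξ j i ω) (k + 1))) ∂μ ≤
      ENNReal.ofReal (Real.exp (L / (4 * N))) *
        ∫⁻ ω, ENNReal.ofReal (Real.exp (L / (2 * R₀ ^ 2) *
          stoppedNoise g G xs α ν R₀ B m x0 (fun j i => ξ j i ω) k)) ∂μ := by
  have hb : Measurable fun ω i => ξ k i ω := measurable_pi_lambda _ fun i => hξ k i
  obtain ⟨hy, hz, hV⟩ := measurable_history (xs := xs) (x0 := x0) (α := α) (ν := ν) (R₀ := R₀)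
    (B := B) (m := m) hg hG k fun j _ i => hξ j i
  have hx : Measurable fun ω =>
      queryPoint α ν k (iterate g α ν B m x0 (fun j i => ξ j i ω) k) :=
    measurable_mix hy hz _ _ _
  have hH := hV.prodMk (hx.prodMk hz)
  have hI := indepFun_history (xs := xs) (x0 := x0) (α := α) (ν := ν) (R₀ := R₀)
    (B := B) (m := m) hg hG hξ hindep k
  obtain ⟨F, hF⟩ : ∃ F : (ℝ × Space n × Space n) × (ℕ → Ξ) → ENNReal, F = fun p =>
      ENNReal.ofReal (Real.exp (L / (2 * R₀ ^ 2) *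
        (p.1.1 + stoppedTerm g G xs α ν R₀ B m k p))) := ⟨_, rfl⟩
  have hFm : Measurable F := by
    rw [hF]
    have := measurable_stoppedTerm (xs := xs) (α := α) (ν := ν) (R₀ := R₀) (B := B) (m := m)
      hg hG k
    fun_prop
  have hN0 : (0 : ℝ) < N := by exact_mod_cast hN
  have hs := stepSize_succ_pos (ν := ν) hα k
  have hind : iIndepFun (fun i => ξ k i) μ :=
    hindep.precomp (g := fun i : ℕ => (k, i)) fun i j hij => by simpa using hij
  have hinner : ∀ h : ℝ × Space n × Space n, ∫⁻ b, F (h, b) ∂(μ.map fun ω i => ξ k i ω) ≤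
      ENNReal.ofReal (Real.exp (L / (4 * N))) *
        ENNReal.ofReal (Real.exp (L / (2 * R₀ ^ 2) * h.1)) := by
    intro h
    have hFh : Measurable fun b => F (h, b) := hFm.comp measurable_prodMk_left
    rw [lintegral_map hFh hb, hF]
    simp only [mul_add, Real.exp_add, ENNReal.ofReal_mul (Real.exp_pos _).le]
    rw [lintegral_const_mul' _ _ ENNReal.ofReal_ne_top, mul_comm]
    gcongr
    by_cases hc : h.1 ≤ 5 / 2 * R₀ ^ 2 ∧ Controlled G xs R₀ (stepSize α ν (k + 1)) B h.2.1 h.2.2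
    · simp only [stoppedTerm, if_pos hc]
      exact lintegral_exp_noiseTerm_le hg (hint _) (hmean _) (hint2 _) (hvar _) (hξ k) (hlaw k)
        hind hm hN hR hL hs hB hc.2 hsize
    · simp only [stoppedTerm, if_neg hc, mul_zero, Real.exp_zero, lintegral_const, measure_univ,
        mul_one]
      exact ENNReal.ofReal_le_ofReal (Real.one_le_exp (by positivity))
  simp only [stoppedNoise_succ]
  calc _ = ∫⁻ ω, F ((stoppedNoise g G xs α ν R₀ B m x0 (fun j i => ξ j i ω) k,
          queryPoint α ν k (iterate g α ν B m x0 (fun j i => ξ j i ω) k),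
          (iterate g α ν B m x0 (fun j i => ξ j i ω) k).z), fun i => ξ k i ω) ∂μ := by
        rw [hF]
    _ = ∫⁻ p, F p ∂(μ.map fun ω => ((stoppedNoise g G xs α ν R₀ B m x0 (fun j i => ξ j i ω) k,
          queryPoint α ν k (iterate g α ν B m x0 (fun j i => ξ j i ω) k),
          (iterate g α ν B m x0 (fun j i => ξ j i ω) k).z), fun i => ξ k i ω)) :=
        (lintegral_map hFm (hH.prodMk hb)).symm
    _ ≤ _ := by
        have : IsProbabilityMeasure (μ.map fun ω i => ξ k i ω) :=
          Measure.isProbabilityMeasure_map hb.aemeasurable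
        rw [hI.map_prod_eq_prod_map_map hH.aemeasurable hb.aemeasurable,
          lintegral_prod _ hFm.aemeasurable]
        refine (lintegral_mono hinner).trans ?_
        rw [lintegral_const_mul _ (by fun_prop), lintegral_map (by fun_prop) hH]

/-- The stopped noise exceeds its threshold with probability at most `exp (-L)`. -/
theorem measure_stoppedNoise_gt_le (hg : Measurable (Function.uncurry g))
    (hint : ∀ x, Integrable (g x) P) (hmean : ∀ x, ∫ s, g x s ∂P = G x)
    (hint2 : ∀ x, Integrable (fun s => ‖g x s - G x‖ ^ 2) P)
    (hvar : ∀ x, ∫ s, ‖g x s - G x‖ ^ 2 ∂P ≤ σ ^ 2)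
    (hξ : ∀ k i, Measurable (ξ k i)) (hlaw : ∀ k i, μ.map (ξ k i) = P)
    (hindep : iIndepFun (fun p : ℕ × ℕ => ξ p.1 p.2) μ)
    (hN : 1 ≤ N) (hR : 0 < R₀) (hL : 2 ≤ L) (hα : 0 < α) (hB : B = C * R₀ / (16 * L))
    (hm : ∀ k < N, 1 ≤ m k)
    (hsize : ∀ k < N,
      20736 * N * σ ^ 2 * stepSize α ν (k + 1) ^ 2 * L / (C ^ 2 * R₀ ^ 2) ≤ m k) :
    1 - Real.exp (-L) ≤ μ.real {ω | stoppedNoise g G xs α ν R₀ B m x0 (fun j i => ξ j i ω) N ≤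
      5 / 2 * R₀ ^ 2} := by
  have hG : Measurable G := by
    have h1 : StronglyMeasurable fun x => ∫ s, g x s ∂P :=
      hg.stronglyMeasurable.integral_prod_right
    rw [funext hmean] at h1
    exact h1.measurable
  have hN0 : (0 : ℝ) < N := by exact_mod_cast hN
  have hV := (measurable_history (xs := xs) (x0 := x0) (α := α) (ν := ν) (R₀ := R₀)
    (B := B) (m := m) hg hG N fun j _ i => hξ j i).2.2
  have hmom : ∀ k ≤ N, ∫⁻ ω, ENNReal.ofReal (Real.exp (L / (2 * R₀ ^ 2) *
      stoppedNoise g G xs α ν R₀ B m x0 (fun j i => ξ j i ω) k)) ∂μ ≤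
      ENNReal.ofReal (Real.exp (k * (L / (4 * N)))) := by
    intro k hk
    induction k with
    | zero => simp [stoppedNoise]
    | succ k ih =>
      refine (lintegral_exp_stoppedNoise_succ_le hg hint hmean hint2 hvar hξ hlaw hindep hG hN hR
        hL hα hB (hm k hk) (hsize k hk)).trans ?_
      calc _ ≤ ENNReal.ofReal (Real.exp (L / (4 * N))) *
            ENNReal.ofReal (Real.exp (k * (L / (4 * N)))) := by gcongr; exact ih (by omega)
        _ = _ := by
          rw [← ENNReal.ofReal_mul (Real.exp_pos _).le, ← Real.exp_add]
          congr 2; push_cast; ring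
  have hNN : (N : ℝ) * (L / (4 * N)) = L / 4 := by field_simp
  have h1 := hmom N le_rfl
  rw [hNN] at h1
  obtain ⟨V, hVdef⟩ : ∃ V : Ω → ℝ, V = fun ω =>
    stoppedNoise g G xs α ν R₀ B m x0 (fun j i => ξ j i ω) N := ⟨_, rfl⟩
  have hVm : Measurable V := hVdef ▸ hV
  change 1 - Real.exp (-L) ≤ μ.real {ω | (fun ω => stoppedNoise g G xs α ν R₀ B m x0
    (fun j i => ξ j i ω) N) ω ≤ 5 / 2 * R₀ ^ 2}
  change ∫⁻ ω, ENNReal.ofReal (Real.exp (L / (2 * R₀ ^ 2) * (fun ω =>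
    stoppedNoise g G xs α ν R₀ B m x0 (fun j i => ξ j i ω) N) ω)) ∂μ ≤ _ at h1
  rw [← hVdef] at h1 ⊢
  have hset : MeasurableSet {ω | V ω ≤ 5 / 2 * R₀ ^ 2} := measurableSet_le hVm measurable_const
  have h2 := mul_meas_ge_le_lintegral (μ := μ)
    (f := fun ω => ENNReal.ofReal (Real.exp (L / (2 * R₀ ^ 2) * V ω))) (by fun_prop)
    (ENNReal.ofReal (Real.exp (5 / 4 * L)))
  have h3 : μ {ω | V ω ≤ 5 / 2 * R₀ ^ 2}ᶜ ≤ ENNReal.ofReal (Real.exp (-L)) := by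
    have e1 : {ω | V ω ≤ 5 / 2 * R₀ ^ 2}ᶜ ⊆ {ω | ENNReal.ofReal (Real.exp (5 / 4 * L)) ≤
        ENNReal.ofReal (Real.exp (L / (2 * R₀ ^ 2) * V ω))} := by
      intro ω hω
      simp only [Set.mem_compl_iff, Set.mem_ofPred_eq, not_le] at hω ⊢
      refine ENNReal.ofReal_le_ofReal (Real.exp_le_exp.2 ?_)
      have e2 : L / (2 * R₀ ^ 2) * (5 / 2 * R₀ ^ 2) = 5 / 4 * L := by field_simp; norm_num
      rw [← e2]
      gcongr
    have e3 : ENNReal.ofReal (Real.exp (5 / 4 * L)) * μ {ω | V ω ≤ 5 / 2 * R₀ ^ 2}ᶜ ≤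
        ENNReal.ofReal (Real.exp (5 / 4 * L)) * ENNReal.ofReal (Real.exp (-L)) := by
      rw [← ENNReal.ofReal_mul (Real.exp_pos _).le, ← Real.exp_add]
      have e4 : 5 / 4 * L + -L = L / 4 := by ring
      rw [e4]
      exact ((mul_le_mul_right (measure_mono e1) _).trans h2).trans h1
    refine (ENNReal.mul_le_mul_iff_right ?_ ENNReal.ofReal_ne_top).1 e3
    exact (ENNReal.ofReal_pos.2 (Real.exp_pos _)).ne'
  have h4 : μ.real {ω | V ω ≤ 5 / 2 * R₀ ^ 2}ᶜ ≤ Real.exp (-L) :=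
    ENNReal.toReal_le_of_le_ofReal (Real.exp_pos _).le h3
  rw [probReal_compl_eq_one_sub hset] at h4
  linarith

end Moment

/-! ### The number of iterations and of oracle calls -/

section Complexity

variable {ν M R₀ ε β a σ q : ℝ} {N : ℕ}

lemma exponent_iter_nonneg (h0 : 0 ≤ ν) : 0 ≤ (1 + ν) / (1 + 3 * ν) := by positivity

lemma exponent_iter_le_one (h0 : 0 ≤ ν) : (1 + ν) / (1 + 3 * ν) ≤ 1 := by
  rw [div_le_one (by linarith)]; linarith

lemma iterationScale_eq_mul_complexityD (ha : 0 ≤ a) :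
    iterationScale ν M R₀ ε a =
      (14 * a) ^ ((1 + ν) / (1 + 3 * ν)) * complexityD ν M R₀ ε := by
  have h1 : (14 : ℝ) = 2 * 7 := by norm_num
  rw [iterationScale, complexityD, h1, Real.mul_rpow (by norm_num) ha,
    Real.mul_rpow (by norm_num) (by norm_num), ← C_rpow_two_mul, mul_div_assoc 2 (1 + ν)]
  ring

lemma complexityD_nonneg (hM : 0 < M) (hR : 0 ≤ R₀) (hε : 0 < ε) :
    0 ≤ complexityD ν M R₀ ε := by
  unfold complexityD; positivity

lemma logFactor_nonneg (hβ : β ∈ Set.Ioo (0 : ℝ) 1) (hN : 1 ≤ N) : 0 ≤ logFactor N β := by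
  have hN' : (1 : ℝ) ≤ N := by exact_mod_cast hN
  refine Real.log_nonneg ?_
  rw [le_div_iff₀ hβ.1]
  linarith [hβ.2]

lemma logFactor_mono (hβ : β ∈ Set.Ioo (0 : ℝ) 1) {N' : ℕ} (hN : 1 ≤ N) (hNN : N ≤ N') :
    logFactor N β ≤ logFactor N' β := by
  have hβ0 := hβ.1
  have hN' : (0 : ℝ) < N := by exact_mod_cast hN
  have hNN' : (N : ℝ) ≤ N' := by exact_mod_cast hNN
  unfold logFactor
  gcongr

open Filter Asymptotics in
/-- The two equations for `a` and `N` have a common solution: the least `N ≥ 1` that is not smaller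
than the prescribed iteration count is a fixed point, as the count is monotone in `N` and grows
only logarithmically. -/
theorem exists_eq_iterationCount (h0 : 0 ≤ ν) (hM : 0 < M) (hR : 0 ≤ R₀) (hε : 0 < ε)
    (hβ : β ∈ Set.Ioo (0 : ℝ) 1) :
    ∃ (a : ℝ) (N : ℕ), a = 16384 * logFactor N β ^ 2 ∧ N = iterationCount ν M R₀ ε a := by
  obtain ⟨D, hD⟩ : ∃ D, D = complexityD ν M R₀ ε := ⟨_, rfl⟩
  have hD0 : 0 ≤ D := hD ▸ complexityD_nonneg hM hR hε
  obtain ⟨φ, hφ⟩ : ∃ φ : ℕ → ℕ, φ = fun N =>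
    iterationCount ν M R₀ ε (16384 * logFactor N β ^ 2) := ⟨_, rfl⟩
  have hφeq : ∀ N, φ N = ⌈(14 * (16384 * logFactor N β ^ 2)) ^ ((1 + ν) / (1 + 3 * ν)) * D⌉₊ + 1 :=
    fun N => by
      rw [hφ]
      simp only
      rw [iterationCount_eq, iterationScale_eq_mul_complexityD (by positivity), hD]
  have hmono : ∀ N N', 1 ≤ N → N ≤ N' → φ N ≤ φ N' := fun N N' hN hNN => by
    rw [hφeq, hφeq]
    have h1 := logFactor_nonneg hβ hN
    have h2 := logFactor_mono hβ hN hNN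
    have h3 := exponent_iter_nonneg h0
    gcongr
  have hex : ∃ N, 1 ≤ N ∧ φ N ≤ N := by
    have h1 : (fun x : ℝ => Real.log x ^ 2) =o[atTop] id :=
      Real.isLittleO_pow_log_id_atTop
    have hc : 0 < β / (4 * (4 * (14 * 16384) * (D + 1))) := by
      have := hβ.1
      positivity
    have h2 : Tendsto (fun N : ℕ => 4 * (N : ℝ) / β) atTop atTop :=
      (tendsto_natCast_atTop_atTop.const_mul_atTop (by norm_num)).atTop_div_const hβ.1
    have h3 := h2.eventually (h1.def hc)
    obtain ⟨N, hN1, hN2, hN3⟩ := (h3.and ((eventually_ge_atTop 1).and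
      (tendsto_natCast_atTop_atTop.eventually_ge_atTop (2 * (D + 2))))).exists
    refine ⟨N, hN2, ?_⟩
    have hN0 : (0 : ℝ) < N := by exact_mod_cast hN2
    have hβ0 := hβ.1
    change ‖logFactor N β ^ 2‖ ≤ _ * ‖4 * (N : ℝ) / β‖ at hN1
    rw [Real.norm_of_nonneg (by positivity), Real.norm_of_nonneg (by positivity)] at hN1
    have h4 : β / (4 * (4 * (14 * 16384) * (D + 1))) * (4 * (N : ℝ) / β) =
      N / (4 * (14 * 16384) * (D + 1)) := by field_simp
    rw [h4, le_div_iff₀ (by positivity)] at hN1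
    have h5 : (14 * (16384 * logFactor N β ^ 2)) ^ ((1 + ν) / (1 + 3 * ν)) ≤
        1 + 14 * (16384 * logFactor N β ^ 2) := by
      calc _ ≤ (1 + 14 * (16384 * logFactor N β ^ 2)) ^ ((1 + ν) / (1 + 3 * ν)) :=
            Real.rpow_le_rpow (by positivity) (by linarith) (exponent_iter_nonneg h0)
        _ ≤ _ := rpow_le_self_of_one_le
            (by linarith [sq_nonneg (logFactor N β)]) (exponent_iter_le_one h0)
    have h6 := Nat.ceil_lt_add_one (a :=
      (14 * (16384 * logFactor N β ^ 2)) ^ ((1 + ν) / (1 + 3 * ν)) * D) (by positivity)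
    have h7 := mul_le_mul_of_nonneg_right h5 hD0
    rw [← Nat.cast_le (α := ℝ), hφeq]
    push_cast
    have h8 : 0 ≤ logFactor N β ^ 2 := sq_nonneg _
    linarith
  classical
  obtain ⟨hN1, hN2⟩ := Nat.find_spec hex
  refine ⟨_, Nat.find hex, rfl, ?_⟩
  have hge : 1 ≤ φ (Nat.find hex) := by rw [hφeq]; omega
  by_contra hne
  have hlt : φ (Nat.find hex) < Nat.find hex := by
    exact lt_of_le_of_ne hN2 fun h => hne (h.symm.trans (congrFun hφ _))
  exact Nat.find_min hex hlt ⟨hge, hmono _ _ hge hN2⟩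

/-- The factor in `ln (4N/β) ≤ c ln (D/β)`, valid for `D / β ≥ q`. -/
noncomputable def logConst (q : ℝ) : ℝ :=
  2 * (Real.log (8 * (14 * 16384)) + 2) / Real.log q + 2

lemma two_le_logConst (hq : 1 < q) : 2 ≤ logConst q := by
  have h1 := Real.log_pos hq
  have h2 : 0 ≤ Real.log (8 * (14 * 16384)) := Real.log_nonneg (by norm_num)
  unfold logConst
  have : 0 ≤ 2 * (Real.log (8 * (14 * 16384)) + 2) / Real.log q := by positivity
  linarith

/-- With `a = 16384 L²` the iteration count involves `N` on both sides, through
`L = ln (4N/β)`; since `N` is at most of order `L² D`, one may replace `L` by `ln (D/β)`. -/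
lemma logFactor_le (hq : 1 < q) (hβ : β ∈ Set.Ioo (0 : ℝ) 1) (hN : 1 ≤ N)
    (hL : 2 ≤ logFactor N β) {D : ℝ} (hND : (N : ℝ) ≤ 2 * (14 * 16384) * logFactor N β ^ 2 * D)
    (hqD : q ≤ D / β) : logFactor N β ≤ logConst q * Real.log (D / β) := by
  have hβ0 := hβ.1
  have hN0 : (0 : ℝ) < N := by exact_mod_cast hN
  obtain ⟨L, hLdef⟩ : ∃ L, L = logFactor N β := ⟨_, rfl⟩
  have hDβ : 0 < D / β := by linarith
  rw [← hLdef] at hL hND ⊢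
  have h1 : L ≤ Real.log (8 * (14 * 16384)) + 2 * Real.log L + Real.log (D / β) := by
    have e1 : 4 * (N : ℝ) / β ≤ 8 * (14 * 16384) * L ^ 2 * (D / β) := by
      rw [← mul_div_assoc]
      exact div_le_div_of_nonneg_right (by linarith) hβ0.le
    calc L = Real.log (4 * (N : ℝ) / β) := hLdef
      _ ≤ Real.log (8 * (14 * 16384) * L ^ 2 * (D / β)) := Real.log_le_log (by positivity) e1
      _ = _ := by
        rw [Real.log_mul (by positivity) hDβ.ne', Real.log_mul (by norm_num) (by positivity),
          Real.log_pow]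
        push_cast
        ring
  have h2 : Real.log L ≤ L / 4 + 1 := by
    have e1 := Real.log_le_sub_one_of_pos (show 0 < L / 4 by linarith)
    rw [Real.log_div (by linarith) (by norm_num)] at e1
    have e2 : Real.log 4 ≤ 2 := by
      rw [show (4 : ℝ) = 2 ^ 2 by norm_num, Real.log_pow]
      push_cast
      linarith [Real.log_two_lt_d9]
    linarith
  have hq0 := Real.log_pos hq
  have h3 : Real.log q ≤ Real.log (D / β) := Real.log_le_log (by linarith) hqD
  have h4 : 0 ≤ Real.log (8 * (14 * 16384)) := Real.log_nonneg (by norm_num)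
  have h5 : 2 * (Real.log (8 * (14 * 16384)) + 2) ≤
      2 * (Real.log (8 * (14 * 16384)) + 2) / Real.log q * Real.log (D / β) := by
    rw [div_mul_eq_mul_div, le_div_iff₀ hq0]
    gcongr
  rw [logConst, add_mul]
  linarith

/-- Bound on the number of iterations. -/
theorem count_le (hq : 1 < q) (h0 : 0 ≤ ν) (hM : 0 < M) (hR : 0 < R₀) (hε : 0 < ε)
    (hβ : β ∈ Set.Ioo (0 : ℝ) 1) (hL : 2 ≤ logFactor N β) (ha : a = 16384 * logFactor N β ^ 2)
    (hX : 100 ≤ iterationScale ν M R₀ ε a) (hN : N = iterationCount ν M R₀ ε a)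
    (hqD : q ≤ complexityD ν M R₀ ε / β) :
    logFactor N β ≤ logConst q * Real.log (complexityD ν M R₀ ε / β) ∧
    (N : ℝ) ≤ 2 * (14 * 16384) * logConst q ^ 2 * (complexityD ν M R₀ ε *
      Real.log (complexityD ν M R₀ ε / β) ^ (2 * (1 + ν) / (1 + 3 * ν))) := by
  have hN1 : 1 ≤ N := by rw [hN, iterationCount_eq]; omega
  have hD0 : 0 ≤ complexityD ν M R₀ ε := complexityD_nonneg hM hR.le hε
  have hr0 := exponent_iter_nonneg h0
  have hr1 := exponent_iter_le_one h0
  have hr : 2 * (1 + ν) / (1 + 3 * ν) = 2 * ((1 + ν) / (1 + 3 * ν)) := by ring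
  have hN2 : (N : ℝ) ≤ 2 * iterationScale ν M R₀ ε a := by
    nth_rw 1 [hN]; exact count_le_two_mul hX
  have ha0 : 0 ≤ a := by rw [ha]; positivity
  rw [iterationScale_eq_mul_complexityD ha0] at hN2
  have h1 : (14 * a) ^ ((1 + ν) / (1 + 3 * ν)) ≤
      14 * 16384 * logFactor N β ^ (2 * (1 + ν) / (1 + 3 * ν)) := by
    have e1 : 14 * a = 14 * 16384 * logFactor N β ^ 2 := by rw [ha]; ring
    rw [e1, Real.mul_rpow (by norm_num) (by positivity), hr, Real.rpow_mul (by linarith)]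
    have e2 : logFactor N β ^ (2 : ℝ) = logFactor N β ^ 2 := by norm_cast
    rw [e2]
    gcongr
    exact rpow_le_self_of_one_le (by norm_num) hr1
  have h2 : (N : ℝ) ≤ 2 * (14 * 16384) * logFactor N β ^ (2 * (1 + ν) / (1 + 3 * ν)) *
      complexityD ν M R₀ ε := by
    have := mul_le_mul_of_nonneg_right h1 hD0
    linarith
  have h3 : logFactor N β ^ (2 * (1 + ν) / (1 + 3 * ν)) ≤ logFactor N β ^ 2 := by
    rw [← Real.rpow_two]
    exact Real.rpow_le_rpow_of_exponent_le (by linarith) (by rw [hr]; linarith)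
  have h4 := logFactor_le hq hβ hN1 hL (h2.trans (by gcongr)) hqD
  refine ⟨h4, h2.trans ?_⟩
  have hℓ : 0 ≤ Real.log (complexityD ν M R₀ ε / β) := Real.log_nonneg (by linarith)
  have hc := two_le_logConst hq
  have h5 : logFactor N β ^ (2 * (1 + ν) / (1 + 3 * ν)) ≤ logConst q ^ 2 *
      Real.log (complexityD ν M R₀ ε / β) ^ (2 * (1 + ν) / (1 + 3 * ν)) := by
    calc _ ≤ (logConst q * Real.log (complexityD ν M R₀ ε / β)) ^
          (2 * (1 + ν) / (1 + 3 * ν)) := Real.rpow_le_rpow (by linarith) h4 (by positivity)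
      _ = logConst q ^ (2 * (1 + ν) / (1 + 3 * ν)) *
          Real.log (complexityD ν M R₀ ε / β) ^ (2 * (1 + ν) / (1 + 3 * ν)) :=
        Real.mul_rpow (by linarith) hℓ
      _ ≤ _ := by
        gcongr
        rw [← Real.rpow_two]
        exact Real.rpow_le_rpow_of_exponent_le (by linarith) (by rw [hr]; linarith)
  calc _ ≤ 2 * (14 * 16384) * (logConst q ^ 2 *
        Real.log (complexityD ν M R₀ ε / β) ^ (2 * (1 + ν) / (1 + 3 * ν))) *
          complexityD ν M R₀ ε := by gcongr
    _ = _ := by ring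

/-- The batches have total size at most `2N` plus a constant multiple of `σ² R₀² L / ε²`, since
`∑ α_{k+1}² ≤ N α_N²` and `α N^{(1+3ν)/(1+ν)}` is of order `R₀² / ε`. -/
theorem oracleCalls_le (h0 : 0 ≤ ν) (h1 : ν ≤ 1) (hM : 0 < M) (hR : 0 < R₀) (hε : 0 < ε)
    (ha : 0 < a) (hL : 0 ≤ logFactor N β)
    (hX : 100 ≤ iterationScale ν M R₀ ε a) (hN : N = iterationCount ν M R₀ ε a) :
    (oracleCalls (batchSize ν M R₀ σ ε β a N) N : ℝ) ≤
      2 * N + 2322432 * (σ ^ 2 * R₀ ^ 2 / ε ^ 2 * logFactor N β) := by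
  obtain ⟨α, hα⟩ : ∃ α, α = stepParam ν M ε a := ⟨_, rfl⟩
  have hα0 : 0 < α := hα ▸ stepParam_pos hM hε ha
  obtain ⟨L, hLdef⟩ : ∃ L, L = logFactor N β := ⟨_, rfl⟩
  rw [← hLdef] at hL ⊢
  have hs0 := exponent_nonneg h0
  have hN1 : 1 ≤ N := by rw [hN, iterationCount_eq]; omega
  have hN0 : (0 : ℝ) < N := by exact_mod_cast hN1
  have hX0 : 0 < iterationScale ν M R₀ ε a := by linarith
  have hp : (1 + 3 * ν) / (1 + ν) = 1 + 2 * ν / (1 + ν) := by field_simp; ring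
  have hp2 : (1 + 3 * ν) / (1 + ν) ≤ 2 := by rw [hp]; linarith [exponent_le_one h0 h1]
  have hp0 : 0 ≤ (1 + 3 * ν) / (1 + ν) := by positivity
  have hαN : α * (N : ℝ) ^ ((1 + 3 * ν) / (1 + ν)) ≤ 28 * R₀ ^ 2 / ε := by
    have e1 : (N : ℝ) ^ ((1 + 3 * ν) / (1 + ν)) ≤
        4 * iterationScale ν M R₀ ε a ^ ((1 + 3 * ν) / (1 + ν)) := by
      calc _ ≤ (2 * iterationScale ν M R₀ ε a) ^ ((1 + 3 * ν) / (1 + ν)) := by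
            refine Real.rpow_le_rpow hN0.le ?_ hp0
            rw [hN]; exact count_le_two_mul hX
        _ = 2 ^ ((1 + 3 * ν) / (1 + ν)) *
            iterationScale ν M R₀ ε a ^ ((1 + 3 * ν) / (1 + ν)) :=
          Real.mul_rpow (by norm_num) hX0.le
        _ ≤ _ := by
          gcongr
          calc (2 : ℝ) ^ ((1 + 3 * ν) / (1 + ν)) ≤ 2 ^ (2 : ℝ) :=
                Real.rpow_le_rpow_of_exponent_le (by norm_num) hp2
            _ = 4 := by norm_num
    calc _ ≤ α * (4 * iterationScale ν M R₀ ε a ^ ((1 + 3 * ν) / (1 + ν))) := by gcongr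
      _ = 4 * (7 * R₀ ^ 2 / ε) := by
        rw [← stepParam_mul_rpow h0 hM hR hε ha, hα]; ring
      _ = _ := by ring
  have hstep : ∀ k < N, stepSize α ν (k + 1) ≤ α * (N : ℝ) ^ (2 * ν / (1 + ν)) := fun k hk => by
    have : (k : ℝ) + 1 ≤ N := by exact_mod_cast hk
    exact mul_le_mul_of_nonneg_left (Real.rpow_le_rpow (by positivity) this hs0) hα0.le
  have hm : ∀ k ∈ Finset.range N, (batchSize ν M R₀ σ ε β a N k : ℝ) ≤
      2 + 20736 * N * σ ^ 2 * (α * (N : ℝ) ^ (2 * ν / (1 + ν))) ^ 2 * L / (7 * R₀ ^ 2) := by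
    intro k hk
    have hk' := hstep k (Finset.mem_range.1 hk)
    have hs := stepSize_succ_pos (ν := ν) hα0 k
    unfold batchSize
    rw [← hα, ← hLdef, C_sq]
    have e1 : 20736 * N * σ ^ 2 * stepSize α ν (k + 1) ^ 2 * L / (7 * R₀ ^ 2) ≤
        20736 * N * σ ^ 2 * (α * (N : ℝ) ^ (2 * ν / (1 + ν))) ^ 2 * L / (7 * R₀ ^ 2) := by
      gcongr
    have e2 : 0 ≤ 20736 * N * σ ^ 2 * stepSize α ν (k + 1) ^ 2 * L / (7 * R₀ ^ 2) := by
      positivity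
    have e3 := Nat.ceil_lt_add_one
      (a := max 1 (20736 * N * σ ^ 2 * stepSize α ν (k + 1) ^ 2 * L / (7 * R₀ ^ 2)))
      (by positivity)
    have e4 : max 1 (20736 * N * σ ^ 2 * stepSize α ν (k + 1) ^ 2 * L / (7 * R₀ ^ 2)) ≤
        1 + 20736 * N * σ ^ 2 * stepSize α ν (k + 1) ^ 2 * L / (7 * R₀ ^ 2) :=
      max_le (by linarith) (by linarith)
    linarith
  rw [oracleCalls]
  push_cast
  refine (Finset.sum_le_sum hm).trans ?_
  rw [Finset.sum_const, Finset.card_range, nsmul_eq_mul]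
  have e5 : (N : ℝ) * (2 + 20736 * N * σ ^ 2 * (α * (N : ℝ) ^ (2 * ν / (1 + ν))) ^ 2 * L /
      (7 * R₀ ^ 2)) =
      2 * N + 20736 * σ ^ 2 * L / (7 * R₀ ^ 2) *
        (α * (N : ℝ) ^ ((1 + 3 * ν) / (1 + ν))) ^ 2 := by
    rw [hp, Real.rpow_add hN0, Real.rpow_one]
    field_simp
  rw [e5]
  have e6 : (α * (N : ℝ) ^ ((1 + 3 * ν) / (1 + ν))) ^ 2 ≤ (28 * R₀ ^ 2 / ε) ^ 2 := by gcongr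
  have e7 : 20736 * σ ^ 2 * L / (7 * R₀ ^ 2) * (28 * R₀ ^ 2 / ε) ^ 2 =
      2322432 * (σ ^ 2 * R₀ ^ 2 / ε ^ 2 * L) := by
    field_simp; ring
  rw [← e7]
  gcongr

end Complexity

/-! ### High-probability bound for admissible parameters -/

namespace Admissible

variable {ν M R₀ ε β a : ℝ} {N : ℕ}

lemma a_pos (h : Admissible ν M R₀ ε β a N) : 0 < a := by
  have h1 := h.a_ge
  have h2 := h.log_ge
  nlinarith

lemma radius_pos (h : Admissible ν M R₀ ε β a N) (h0 : 0 ≤ ν) (hR : 0 ≤ R₀) (hε : 0 < ε) :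
    0 < R₀ := by
  rcases hR.lt_or_eq with h1 | h1
  · exact h1
  · have h2 := h.eps_le₂
    rw [← h1, Real.zero_rpow (by linarith)] at h2
    simp only [mul_zero, zero_mul, zero_div] at h2
    linarith

lemma hundred_le (h : Admissible ν M R₀ ε β a N) (h0 : 0 ≤ ν) (hM : 0 < M) (hR : 0 < R₀)
    (hε : 0 < ε) : 100 ≤ iterationScale ν M R₀ ε a :=
  hundred_le_iterationScale h0 hM hR hε h.a_pos h.eps_le₂

lemma tuned (h : Admissible ν M R₀ ε β a N) (h0 : 0 ≤ ν) (h1 : ν ≤ 1) (hM : 0 < M) (hR : 0 < R₀)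
    (hε : 0 < ε) : Tuned ν M R₀ (stepParam ν M ε a) (logFactor N β) N :=
  tuned_stepParam h0 h1 hM hR hε h.log_ge h.a_ge (h.hundred_le h0 hM hR hε) h.count_eq

/-- The gap guaranteed by the analysis, in terms of the accuracy. -/
lemma gap_le_eps (h : Admissible ν M R₀ ε β a N) (h0 : 0 ≤ ν) (hM : 0 < M) (hR : 0 < R₀)
    (hε : 0 < ε) :
    7 * R₀ ^ 2 / (stepParam ν M ε a * (N : ℝ) ^ ((1 + 3 * ν) / (1 + ν))) ≤ ε := by
  have hα := stepParam_pos (ν := ν) hM hε h.a_pos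
  have hX : 0 < iterationScale ν M R₀ ε a := by linarith [h.hundred_le h0 hM hR hε]
  have h1 := stepParam_mul_rpow h0 hM hR hε h.a_pos
  have h2 : iterationScale ν M R₀ ε a ≤ N := by
    rw [h.count_eq]; exact iterationScale_le_count
  have h3 : 7 * R₀ ^ 2 / ε ≤ stepParam ν M ε a * (N : ℝ) ^ ((1 + 3 * ν) / (1 + ν)) := by
    rw [← h1]; gcongr
  rw [div_le_iff₀ hε] at h3
  have hN0 : 0 < stepParam ν M ε a * (N : ℝ) ^ ((1 + 3 * ν) / (1 + ν)) := by
    have : (0 : ℝ) < N := by exact_mod_cast h.one_le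
    positivity
  rw [div_le_iff₀ hN0]
  linarith

/-- The gap guaranteed by the analysis, in terms of the number of iterations. -/
lemma gap_le_rate (h : Admissible ν M R₀ ε β a N) (h0 : 0 ≤ ν) (hM : 0 < M) (hε : 0 < ε) :
    7 * R₀ ^ 2 / (stepParam ν M ε a * (N : ℝ) ^ ((1 + 3 * ν) / (1 + ν))) ≤
      4 * a * C ^ 2 * R₀ ^ 2 * M ^ (2 / (1 + ν)) /
        ((N : ℝ) ^ ((1 + 3 * ν) / (1 + ν)) * ε ^ ((1 - ν) / (1 + ν))) := by
  have ha := h.a_pos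
  have hN : (0 : ℝ) < N := by exact_mod_cast h.one_le
  rw [stepParam_eq h0 hε, C_sq]
  have h1 : 7 * R₀ ^ 2 / (ε ^ ((1 - ν) / (1 + ν)) / (2 * a * M ^ (2 / (1 + ν))) *
      (N : ℝ) ^ ((1 + 3 * ν) / (1 + ν))) = 2 * a * 7 * R₀ ^ 2 * M ^ (2 / (1 + ν)) /
        ((N : ℝ) ^ ((1 + 3 * ν) / (1 + ν)) * ε ^ ((1 - ν) / (1 + ν))) := by
    field_simp
  rw [h1]
  gcongr
  norm_num

lemma exp_neg_le (h : Admissible ν M R₀ ε β a N) (hβ : 0 < β) :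
    Real.exp (-logFactor N β) ≤ β := by
  have hN : (1 : ℝ) ≤ N := by exact_mod_cast h.one_le
  rw [Real.exp_neg, logFactor, Real.exp_log (by positivity), inv_div, div_le_iff₀ (by positivity)]
  nlinarith

end Admissible

/-- The core of the result: with probability at least `1 - β` the gap of the output is at most
`7 R₀² / (α N^{(1+3ν)/(1+ν)})`. -/
theorem measure_gap_le {n : ℕ} {f : Space n → ℝ} {G : Space n → Space n} {xs x0 : Space n}
    {ν M R₀ : ℝ} (h : LocallyHolder f G xs ν M R₀) (hx0 : ‖x0 - xs‖ ≤ R₀)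
    {Ξ : Type*} [MeasurableSpace Ξ] {P : Measure Ξ} [IsProbabilityMeasure P]
    {g : Space n → Ξ → Space n} {σ : ℝ} (hg : Measurable (Function.uncurry g))
    (hint : ∀ x, Integrable (g x) P) (hmean : ∀ x, ∫ s, g x s ∂P = G x)
    (hint2 : ∀ x, Integrable (fun s => ‖g x s - G x‖ ^ 2) P)
    (hvar : ∀ x, ∫ s, ‖g x s - G x‖ ^ 2 ∂P ≤ σ ^ 2)
    {Ω : Type*} [MeasurableSpace Ω] {μ : Measure Ω} [IsProbabilityMeasure μ]
    {ξ : ℕ → ℕ → Ω → Ξ} (hξ : ∀ k i, Measurable (ξ k i)) (hlaw : ∀ k i, μ.map (ξ k i) = P)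
    (hindep : iIndepFun (fun p : ℕ × ℕ => ξ p.1 p.2) μ) {ε β a : ℝ} {N : ℕ} (hε : 0 < ε)
    (hβ : 0 < β) (hA : Admissible ν M R₀ ε β a N) (hR : 0 < R₀) {r : ℝ}
    (hr : 7 * R₀ ^ 2 / (stepParam ν M ε a * (N : ℝ) ^ ((1 + 3 * ν) / (1 + ν))) ≤ r) :
    1 - β ≤ μ.real {ω | f (output g ν M R₀ σ ε β a N x0 (fun k i => ξ k i ω)) - f xs ≤ r} := by
  have T := hA.tuned h.nonneg h.le_one h.const_pos hR hε
  have hB : clipParam R₀ β N = C * R₀ / (16 * logFactor N β) := rfl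
  have h1 := measure_stoppedNoise_gt_le (xs := xs) (x0 := x0) (ν := ν)
    (m := batchSize ν M R₀ σ ε β a N) hg hint hmean hint2 hvar hξ hlaw hindep T.one_le hR
    T.two_le_log T.step_pos hB
    (fun k _ => by
      unfold batchSize
      rw [Nat.one_le_ceil_iff]
      exact lt_max_of_lt_left one_pos)
    (fun k _ => (le_max_right _ _).trans (Nat.le_ceil _))
  have h2 := hA.exp_neg_le hβ
  refine (by linarith : 1 - β ≤ 1 - Real.exp (-logFactor N β)).trans (h1.trans ?_)
  exact measureReal_mono fun ω hω => (gap_le_of_stoppedNoise_le h T hB hx0 hω).trans hr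

end ClippedSSTM

open ClippedSSTM in
theorem mainTheorem1 (q : ℝ) (hq : 1 < q) :
    -- the constant of the complexity bounds: it depends on nothing but `q`
    ∃ c : ℝ, 0 < c ∧
    ∀ (n : ℕ)
      -- the objective, its (sub)gradient field `G`, a minimizer and the starting point
      (f : ClippedSSTM.Space n → ℝ) (G : ClippedSSTM.Space n → ClippedSSTM.Space n)
      (xs x0 : ClippedSSTM.Space n) (ν M R₀ : ℝ)
      (_hν : ν ∈ Set.Icc (0 : ℝ) 1) (_hM : 0 < M)
      (_hf : ConvexOn ℝ Set.univ f) (_hmin : ∀ x, f xs ≤ f x)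
      -- `G x` is a subgradient of `f` at every `x`; so `G x = ∇f(x)` wherever `f` is differentiable
      (_hG : ∀ x y, f x + inner ℝ (G x) (y - x) ≤ f y)
      -- if `f` is not differentiable at the minimizer, the subgradient chosen there is zero
      (_hG0 : ¬ DifferentiableAt ℝ f xs → G xs = 0)
      (_hR₀ : ‖x0 - xs‖ ≤ R₀)
      (_hHolder : ∀ x ∈ Metric.closedBall xs (3 * R₀), ∀ y ∈ Metric.closedBall xs (3 * R₀),
        ‖G x - G y‖ ≤ M * ‖x - y‖ ^ ν)
      -- the stochastic oracle `g x s = ∇f(x, s)`, `s` of law `P`: unbiased, of variance `≤ σ²`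
      (Ξ : Type*) [MeasurableSpace Ξ] (P : Measure Ξ) [IsProbabilityMeasure P]
      (g : ClippedSSTM.Space n → Ξ → ClippedSSTM.Space n) (σ : ℝ) (_hσ : 0 < σ)
      (_hg : Measurable (Function.uncurry g))
      (_hint : ∀ x, Integrable (g x) P)
      (_hmean : ∀ x, ∫ s, g x s ∂P = G x)
      (_hint2 : ∀ x, Integrable (fun s => ‖g x s - G x‖ ^ 2) P)
      (_hvar : ∀ x, ∫ s, ‖g x s - G x‖ ^ 2 ∂P ≤ σ ^ 2)
      -- i.i.d. samples `ξ k i` of law `P`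
      (Ω : Type*) [MeasurableSpace Ω] (μ : Measure Ω) [IsProbabilityMeasure μ]
      (ξ : ℕ → ℕ → Ω → Ξ) (_hξ : ∀ k i, Measurable (ξ k i))
      (_hlaw : ∀ k i, μ.map (ξ k i) = P)
      (_hindep : iIndepFun (fun p : ℕ × ℕ => ξ p.1 p.2) μ)
      -- accuracy and confidence level
      (ε β : ℝ) (_hε : 0 < ε) (_hβ : β ∈ Set.Ioo (0 : ℝ) 1),
      -- the high-probability rate
      (∀ (a : ℝ) (N : ℕ), ClippedSSTM.Admissible ν M R₀ ε β a N →
        1 - β ≤ μ.real {ω | f (ClippedSSTM.output g ν M R₀ σ ε β a N x0 (fun k i => ξ k i ω)) - f xs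
          ≤ 4 * a * ClippedSSTM.C ^ 2 * R₀ ^ 2 * M ^ (2 / (1 + ν)) /
            ((N : ℝ) ^ ((1 + 3 * ν) / (1 + ν)) * ε ^ ((1 - ν) / (1 + ν)))}) ∧
      -- the choice `a = 16384 ln² (4N/β)`, with `N` itself given by `a`, can be made
      (∃ (a : ℝ) (N : ℕ), a = 16384 * ClippedSSTM.logFactor N β ^ 2 ∧
        N = ClippedSSTM.iterationCount ν M R₀ ε a) ∧
      -- with this choice: accuracy `ε`, the number of iterations and the number of oracle calls
      (∀ (a : ℝ) (N : ℕ), ClippedSSTM.Admissible ν M R₀ ε β a N →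
        a = 16384 * ClippedSSTM.logFactor N β ^ 2 →
        1 - β ≤ μ.real {ω | f (ClippedSSTM.output g ν M R₀ σ ε β a N x0 (fun k i => ξ k i ω)) - f xs
          ≤ ε} ∧
        (q ≤ ClippedSSTM.complexityD ν M R₀ ε / β →
          (N : ℝ) ≤ c * (ClippedSSTM.complexityD ν M R₀ ε *
            Real.log (ClippedSSTM.complexityD ν M R₀ ε / β) ^ (2 * (1 + ν) / (1 + 3 * ν))) ∧
          (ClippedSSTM.oracleCalls (ClippedSSTM.batchSize ν M R₀ σ ε β a N) N : ℝ) ≤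
            c * max
              (ClippedSSTM.complexityD ν M R₀ ε *
                Real.log (ClippedSSTM.complexityD ν M R₀ ε / β) ^ (2 * (1 + ν) / (1 + 3 * ν)))
              (σ ^ 2 * R₀ ^ 2 / ε ^ 2 *
                Real.log (ClippedSSTM.complexityD ν M R₀ ε / β)))) := by
  have hc := two_le_logConst hq
  refine ⟨4 * (14 * 16384) * logConst q ^ 2 + 2322432 * logConst q, by positivity, ?_⟩
  intro n f G xs x0 ν M R₀ hν hM _ hmin hG hG0 hx0 hHolder Ξ _ P _ g σ _ hg hint hmean hint2 hvar
    Ω _ μ _ ξ hξ hlaw hindep ε β hε hβ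
  have hR' : 0 ≤ R₀ := (norm_nonneg _).trans hx0
  have hGxs : G xs = 0 := by
    by_cases hd : DifferentiableAt ℝ f xs
    · exact subgradient_eq_zero_of_isMin hmin (hG xs) hd
    · exact hG0 hd
  have hH : LocallyHolder f G xs ν M R₀ := ⟨hν.1, hν.2, hM, hG, hGxs, hHolder⟩
  refine ⟨fun a N hA => ?_, exists_eq_iterationCount hν.1 hM hR' hε hβ, fun a N hA ha => ⟨?_, ?_⟩⟩
  · exact measure_gap_le hH hx0 hg hint hmean hint2 hvar hξ hlaw hindep hε hβ.1 hA
      (hA.radius_pos hν.1 hR' hε) (hA.gap_le_rate hν.1 hM hε)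
  · have hR := hA.radius_pos hν.1 hR' hε
    exact measure_gap_le hH hx0 hg hint hmean hint2 hvar hξ hlaw hindep hε hβ.1 hA hR
      (hA.gap_le_eps hν.1 hM hR hε)
  · intro hqD
    have hR := hA.radius_pos hν.1 hR' hε
    have hX := hA.hundred_le hν.1 hM hR hε
    obtain ⟨h1, h2⟩ := count_le hq hν.1 hM hR hε hβ hA.log_ge ha hX hA.count_eq hqD
    have h3 := oracleCalls_le (σ := σ) hν.1 hν.2 hM hR hε hA.a_pos
      (by linarith [hA.log_ge] : 0 ≤ logFactor N β) hX hA.count_eq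
    have hD := complexityD_nonneg (ν := ν) hM hR' hε
    have hℓ : 0 ≤ Real.log (complexityD ν M R₀ ε / β) := Real.log_nonneg (by linarith)
    obtain ⟨T, hT⟩ : ∃ T, T = complexityD ν M R₀ ε *
      Real.log (complexityD ν M R₀ ε / β) ^ (2 * (1 + ν) / (1 + 3 * ν)) := ⟨_, rfl⟩
    obtain ⟨S, hS⟩ : ∃ S, S = σ ^ 2 * R₀ ^ 2 / ε ^ 2 *
      Real.log (complexityD ν M R₀ ε / β) := ⟨_, rfl⟩
    have hT0 : 0 ≤ T := by rw [hT]; positivity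
    have h4 : σ ^ 2 * R₀ ^ 2 / ε ^ 2 * logFactor N β ≤ logConst q * S := by
      calc _ ≤ σ ^ 2 * R₀ ^ 2 / ε ^ 2 *
            (logConst q * Real.log (complexityD ν M R₀ ε / β)) := by gcongr
        _ = _ := by rw [hS]; ring
    rw [← hT] at h2 ⊢
    rw [← hS]
    have hc2 : 0 ≤ logConst q ^ 2 * T := by positivity
    have hc1 : 0 ≤ logConst q * T := by positivity
    refine ⟨by linarith, ?_⟩
    have h5 : logConst q ^ 2 * T ≤ logConst q ^ 2 * max T S := by gcongr; exact le_max_left _ _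
    have h6 : logConst q * S ≤ logConst q * max T S := by gcongr; exact le_max_right _ _
    linarith
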